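/- Conventions. Let $E$ be a finite-dimensional real vector space and $F$ a real Fréchet space. Let $U\subseteq E$ (or, inductively, $U\subseteq E\times E$, and so on) be a set with dense interior, that is, $U\subseteq\overline{\operatorname{int}U}$. A map $f:U\to F$ is called $C^0$ if it is continuous. It is called $C^1$ if it is continuous, the directional derivatives $df(x).v=\lim_{h\to0}\frac{f(x+hv)-f(x)}{h}$ exist for all $x\in\operatorname{int}U$ and $v\in E$, and $(x,v)\mapsto df(x).v$ extends to a continuous map $df:U\times E\to F$. It is called $C^{n+1}$ if it is $C^1$ and $df$ is $C^n$, and smooth if it is $C^n$ for all $n$. For linear functionals $\lambda_1,\dots,\lambda_N$ on $E$ ($N\ge 0$) put $E^+=\bigcap_{k}\lambda_k^{-1}([0,\infty))$. A differential structure with corners on a Hausdorff space $X$ is a set of homeomorphisms (charts) from open subsets of $X$ onto relatively open subsets of $E^+$, whose images have dense interior in $E$, whose domains cover $X$, and all of whose coordinate changes are smooth; $X$ is then called a smooth manifold with corners. A map $f:X\to F$ is smooth if $f\circ\varphi^{-1}$ is smooth for each chart $\varphi$ of the structure. **Proposition.** 1. Let $M$ be a paracompact Hausdorff smooth manifold modelled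 on $E$ (without boundary). Let $L\subseteq M$ have dense interior, $L\subseteq\overline{\operatorname{int}L}$, and suppose that, for some $\lambda_1,\dots,\lambda_N$, $L$ is a smooth manifold with corners with respect to the restrictions $\varphi|_{L\cap \operatorname{dom}\varphi}$ of those charts $\varphi$ of $M$ for which $\varphi(L\cap\operatorname{dom}\varphi)$ is relatively open in $E^+$. Then there exists an open subset $U\subseteq M$ with $L\subseteq U$ such that for each smooth $f:L\to F$ there exists a smooth $\bar f:U\to F$ with $\bar f|_L=f$. 2. In particular, if $E^+$ has non-empty interior and $U\subseteq E^+$ is relatively open, then there exists an open subset $\widetilde U\subseteq E$ with $U\subseteq\widetilde U$ such that for each smooth $f:U\to F$ there exists a smooth $\tilde f:\widetilde U\to F$ with $\tilde f|_U=f$. 3. Consequently, on finite-dimensional manifolds with corners the above notion of smoothness agrees with the usual one (local extendability): if $X$ is a smooth manifold with corners modelled on $E$, then $f:X\to F$ is smooth if and only if for each chart $\varphi$ of the differential structure and each $x$ in the image of $\varphi$ there are an open neighbourhood $V$ of $x$ in $E$ and a smooth map $g:V\to F$ with $g=f\circ\varphi^{-1}$ on $V\cap\operatorname{im}\varphi$.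 -/

import Mathlib

open Set Filter Topology
open scoped Manifold ContDiff

universe u v

namespace Corners

section Calculus

variable {F : Type v} [AddCommGroup F] [Module ℝ F] [TopologicalSpace F]

/-- `df` restricts on `U × E` to the differential of the `C¹`-map `f : U → F`: `f` is continuous
on `U`, the directional derivatives of `f` exist on the interior of `U`, and `df` is a continuous
map on `U × E` which gives these derivatives over the interior of `U`.
Only the values of `f` on `U` and of `df` on `U × E` matter. -/
def IsDifferentialOn {E : Type u} [AddCommGroup E] [Module ℝ E] [TopologicalSpace E]
    (f : E → F) (U : Set E) (df : E × E → F) : Prop :=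
  ContinuousOn f U ∧
  (∀ x ∈ interior U, ∀ v : E,
    Tendsto (fun h : ℝ => h⁻¹ • (f (x + h • v) - f x)) (𝓝[≠] 0) (𝓝 (df (x, v)))) ∧
  ContinuousOn df (U ×ˢ univ)

/-- `f : U → F` is of class `C^n`, for a set `U` with dense interior in a locally convex space
(for Hausdorff `F` the differential `df` is then unique on `U × E`). `C^0` means continuous, and
`C^(n+1)` means `C^1` with differential `df : U × E → F` of class `C^n`. For open `U` this
is the usual (Michal-Bastiani) notion of a `C^n`-map. -/
def IsCn : ∀ (_ : ℕ) {E : Type u} [AddCommGroup E] [Module ℝ E] [TopologicalSpace E],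
    (E → F) → Set E → Prop
  | 0, _, _, _, _, f, U => ContinuousOn f U
  | n + 1, E, _, _, _, f, U =>
      ∃ df : E × E → F, IsDifferentialOn f U df ∧ IsCn n df (U ×ˢ (univ : Set E))

/-- `f : U → F` is smooth. -/
def IsSmooth {E : Type u} [AddCommGroup E] [Module ℝ E] [TopologicalSpace E]
    (f : E → F) (U : Set E) : Prop :=
  ∀ n : ℕ, IsCn n f U

/-- Smoothness of `f : U → F` in the local-extension sense: every point of `U` has an open
neighbourhood `V` in `E` with a smooth map on the open set `V` that agrees with `f` on `U ∩ V`. -/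
def IsLocallyExtendable {E : Type u} [AddCommGroup E] [Module ℝ E] [TopologicalSpace E]
    (f : E → F) (U : Set E) : Prop :=
  ∀ x ∈ U, ∃ V : Set E, IsOpen V ∧ x ∈ V ∧ ∃ g : E → F, IsSmooth g V ∧ EqOn g f (U ∩ V)

end Calculus

section Manifolds

variable {E : Type u} [AddCommGroup E] [Module ℝ E] [TopologicalSpace E]

/-- `E⁺`, the set on which finitely many continuous linear functionals are nonnegative. -/
def cone {N : ℕ} (l : Fin N → E →L[ℝ] ℝ) : Set E := {x | ∀ k, 0 ≤ l k x}

/-- A chart of `X`: a homeomorphism from an open subset of `X` onto a relatively open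
subset of `E⁺`. -/
structure CornerChart (X : Type*) [TopologicalSpace X] {N : ℕ} (l : Fin N → E →L[ℝ] ℝ)
    extends PartialEquiv X E where
  isOpen_source : IsOpen source
  isOpen_target : ∃ O : Set E, IsOpen O ∧ target = O ∩ cone l
  continuousOn_toFun : ContinuousOn toFun source
  continuousOn_invFun : ContinuousOn invFun target

/-- The charts in `A` form a differential structure on `X`, that is, they cover `X`, their images
have dense interior in `E`, and all coordinate changes are smooth. A Hausdorff space with a
differential structure is a smooth manifold with corners. -/
structure IsDifferentialStructure {X : Type*} [TopologicalSpace X] {N : ℕ}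
    {l : Fin N → E →L[ℝ] ℝ} (A : Set (CornerChart X l)) : Prop where
  cover : ∀ x : X, ∃ φ ∈ A, x ∈ φ.source
  dense_interior : ∀ φ ∈ A, φ.target ⊆ closure (interior φ.target)
  smooth_change : ∀ φ ∈ A, ∀ ψ ∈ A,
    IsSmooth (ψ.toPartialEquiv ∘ φ.toPartialEquiv.symm)
      (φ.toPartialEquiv '' (φ.source ∩ ψ.source))

/-- `f : X → F` is smooth with respect to the differential structure `A`: all its coordinate
representations are smooth. -/
def IsSmoothMap {F : Type v} [AddCommGroup F] [Module ℝ F] [TopologicalSpace F]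
    {X : Type*} [TopologicalSpace X] {N : ℕ} {l : Fin N → E →L[ℝ] ℝ}
    (A : Set (CornerChart X l)) (f : X → F) : Prop :=
  ∀ φ ∈ A, IsSmooth (f ∘ φ.toPartialEquiv.symm) φ.target

/-- `f : X → F` is smooth in the usual sense: all its coordinate representations
extend locally to smooth maps on open subsets of `E`. -/
def IsUsualSmoothMap {F : Type v} [AddCommGroup F] [Module ℝ F] [TopologicalSpace F]
    {X : Type*} [TopologicalSpace X] {N : ℕ} {l : Fin N → E →L[ℝ] ℝ}
    (A : Set (CornerChart X l)) (f : X → F) : Prop :=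
  ∀ φ ∈ A, IsLocallyExtendable (f ∘ φ.toPartialEquiv.symm) φ.target

end Manifolds

/-- The charts of the subset `L` of the smooth manifold `M` which are restrictions to `L` of charts
`φ` of `M` (those for which the image of `L ∩ dom φ` is a relatively open subset of `E⁺`).
For an empty family of functionals `E⁺ = E`; if `L` is moreover open in `M`, then the restrictions
of all charts of `M` are obtained. -/
def restrictedCharts {E : Type*} [NormedAddCommGroup E] [NormedSpace ℝ E]
    {M : Type*} [TopologicalSpace M] [ChartedSpace E M]
    (L : Set M) {N : ℕ} (l : Fin N → E →L[ℝ] ℝ) : Set (CornerChart L l) :=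
  {ψ | ∃ φ ∈ IsManifold.maximalAtlas 𝓘(ℝ, E) ∞ M,
    ψ.source = Subtype.val ⁻¹' φ.source ∧ ∀ x ∈ ψ.source, ψ.toPartialEquiv x = φ (x : M)}

end Corners

namespace Corners

/-! ### Coefficients with prescribed moments -/

section SeeleyCoefficients

/-! The heart is Seeley's reflection. Fix coefficients `a k` with `∑ a k * (-2 ^ k) ^ n = 1` for
every `n`, all these series converging absolutely. If `λ e = 1`, let `A k` multiply `e` by `-2 ^ k`
and fix `ker λ`. A smooth function `g` of bounded support on the side `0 ≤ λ` is continued to the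
other side by `∑ a k • g (A k x)`. The `m`-th derivatives of the terms are bounded by a constant
times `|a k| * (2 ^ k) ^ m`, so the series may be differentiated termwise. On `λ = 0` the moment
conditions make all derivatives from the two sides agree (`contDiffOn_seeleyExtension`). For a cone,
one functional is removed at a time. With `e` a multiple of an interior point of the cone, the
reflections respect the remaining constraints (`exists_smooth_extension_of_cone`).

Values in a Fréchet space are handled seminorm by seminorm. On relatively open pieces of closed
convex sets with nonempty interior, smoothness in the sense of directional derivatives is equivalent
to `ContDiffOn` of all compositions with the maps to the local Banach spaces
(`isSmooth_iff_seminormwiseSmoothOn`); completeness puts the derivatives back into `F`. The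
extension itself is defined in `F`, since bounded support leaves only finitely many nonzero terms
wherever `λ x ≠ 0`.

A cutoff makes the cone result local, on neighbourhoods chosen before the function. Smooth
partitions of unity, built on second countable pieces of the paracompact manifold, glue the local
extensions (`exists_glue`). This gives the extension from `L` and from open subsets of the cone; the
comparison of the two notions of smoothness follows chart by chart. -/

theorem summable_prod_two_div_two_pow (n : ℕ) :
    Summable fun k : ℕ => (∏ i ∈ Finset.range k, (2 / 2 ^ i : ℝ)) * (2 ^ k) ^ n := by
  have hpos : ∀ k : ℕ, 0 < (∏ i ∈ Finset.range k, (2 / 2 ^ i : ℝ)) * (2 ^ k) ^ n := fun k =>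
    mul_pos (Finset.prod_pos fun i _ => by positivity) (by positivity)
  refine summable_of_ratio_test_tendsto_lt_one (l := 0) zero_lt_one
    (Eventually.of_forall fun k => (hpos k).ne') ?_
  have h : ∀ k : ℕ, ‖(∏ i ∈ Finset.range (k + 1), (2 / 2 ^ i : ℝ)) * (2 ^ (k + 1)) ^ n‖ /
      ‖(∏ i ∈ Finset.range k, (2 / 2 ^ i : ℝ)) * (2 ^ k) ^ n‖ = 2 * 2 ^ n * (1 / 2) ^ k := by
    intro k
    rw [Real.norm_of_nonneg (hpos _).le, Real.norm_of_nonneg (hpos _).le,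
      div_eq_iff (hpos k).ne', Finset.prod_range_succ, pow_succ (2 : ℝ) k, mul_pow]
    simp only [one_div, inv_pow]
    ring
  simp only [h]
  simpa using (tendsto_pow_atTop_nhds_zero_of_lt_one (r := (1 / 2 : ℝ)) (by norm_num)
    (by norm_num)).const_mul (2 * 2 ^ n)

theorem sum_two_pow_div_two_pow_le (k N : ℕ) :
    ∑ j ∈ (Finset.range N).filter (k < ·), (2 ^ k / 2 ^ j : ℝ) ≤ 1 := by
  -- The exact geometric sum is kept so that the induction closes; the maximum with `0` covers `N <
  -- k`, where the sum is empty.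
  have h : ∀ N : ℕ, ∑ j ∈ (Finset.range (N + 1)).filter (k < ·), (2 ^ k / 2 ^ j : ℝ) ≤
      max 0 (1 - 2 ^ k / 2 ^ N) := by
    intro N
    induction N with
    | zero => simp [Finset.filter_singleton]
    | succ N ih =>
      rw [Finset.range_add_one, Finset.filter_insert]
      split_ifs with hk
      · rw [Finset.sum_insert (by simp)]
        have h1 : (2 ^ k / 2 ^ N : ℝ) ≤ 1 :=
          div_le_one_of_le₀ (pow_le_pow_right₀ one_le_two (by omega)) (by positivity)
        rw [max_eq_right (by linarith)] at ih
        refine le_max_of_le_right ?_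
        rw [pow_succ (2 : ℝ) N] at *
        have : (2 ^ k / (2 ^ N * 2) : ℝ) = 2 ^ k / 2 ^ N / 2 := by rw [div_div]
        linarith
      · refine ih.trans ?_
        gcongr 0 ⊔ (1 - 2 ^ k / 2 ^ ?_)
        · norm_num
        · omega
  refine (Finset.sum_le_sum_of_subset_of_nonneg (Finset.filter_subset_filter _
    (Finset.range_mono N.le_succ)) fun _ _ _ => by positivity).trans ((h N).trans ?_)
  have : (0 : ℝ) ≤ 2 ^ k / 2 ^ N := by positivity
  exact max_le zero_le_one (by linarith)

/-- The absolute value is the product of `(1 + 2 ^ j) / |2 ^ j - 2 ^ k|` over `j ≠ k`. Factors with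
`j > k` are at most `exp (4 * 2 ^ k / 2 ^ j)`, so their product is at most `exp 4` uniformly in `N`.
A factor with `j < k` is at most `2 / 2 ^ (k - 1 - j)`, which gives the superexponential decay in
`k`. -/
theorem abs_eval_one_lagrangeBasis_le (N k : ℕ) (hk : k ∈ Finset.range N) :
    |(Lagrange.basis (Finset.range N) (fun j => -(2 : ℝ) ^ j) k).eval 1| ≤
      Real.exp 4 * ∏ i ∈ Finset.range k, (2 / 2 ^ i : ℝ) := by
  have hk' : k < N := Finset.mem_range.1 hk
  have hval : |(Lagrange.basis (Finset.range N) (fun j => -(2 : ℝ) ^ j) k).eval 1| =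
      ∏ j ∈ (Finset.range N).erase k, |(1 + 2 ^ j) / (2 ^ j - 2 ^ k : ℝ)| := by
    rw [Lagrange.basis, Polynomial.eval_prod, Finset.abs_prod]
    refine Finset.prod_congr rfl fun j _ => ?_
    simp only [Lagrange.basisDivisor, Polynomial.eval_mul, Polynomial.eval_C, Polynomial.eval_sub,
      Polynomial.eval_X]
    congr 1
    rw [div_eq_mul_inv, mul_comm]
    congr 1 <;> [ring; (congr 1; ring)]
  have hsplit : (Finset.range N).erase k =
      Finset.range k ∪ (Finset.range N).filter (k < ·) := by
    ext j; simp; omega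
  have hdisj : Disjoint (Finset.range k) ((Finset.range N).filter (k < ·)) := by
    rw [Finset.disjoint_left]; intro j; simp; omega
  rw [hval, hsplit, Finset.prod_union hdisj, mul_comm]
  refine mul_le_mul ?_ ?_ (Finset.prod_nonneg fun _ _ => abs_nonneg _) (Real.exp_pos _).le
  · calc ∏ j ∈ (Finset.range N).filter (k < ·), |(1 + 2 ^ j) / (2 ^ j - 2 ^ k : ℝ)|
        ≤ ∏ j ∈ (Finset.range N).filter (k < ·), Real.exp (4 * (2 ^ k / 2 ^ j)) := by
          refine Finset.prod_le_prod (fun _ _ => abs_nonneg _) fun j hj => ?_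
          have hkj : k + 1 ≤ j := (Finset.mem_filter.1 hj).2
          have h1 : (2 : ℝ) ^ k * 2 ≤ 2 ^ j := by
            rw [← pow_succ]; exact pow_le_pow_right₀ one_le_two hkj
          have h2 : (1 : ℝ) ≤ 2 ^ k := one_le_pow₀ one_le_two
          have h3 : (0 : ℝ) < 2 ^ j - 2 ^ k := by linarith
          rw [abs_of_nonneg (by positivity)]
          refine le_trans ?_ (Real.add_one_le_exp _)
          rw [div_le_iff₀ h3]
          have h4 : (2 : ℝ) ^ k / 2 ^ j * 2 ^ j = 2 ^ k := div_mul_cancel₀ _ (by positivity)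
          have h5 : (2 : ℝ) ^ k / 2 ^ j ≤ 1 / 2 := by
            rw [div_le_iff₀ (by positivity)]; linarith
          have h6 : (2 : ℝ) ^ k / 2 ^ j * 2 ^ k ≤ 1 / 2 * 2 ^ k := by gcongr
          nlinarith
      _ ≤ Real.exp 4 := by
          rw [← Real.exp_sum, ← Finset.mul_sum]
          have := sum_two_pow_div_two_pow_le k N
          exact Real.exp_le_exp.2 (by linarith)
  · rw [← Finset.prod_range_reflect (fun i => (2 / 2 ^ i : ℝ))]
    refine Finset.prod_le_prod (fun _ _ => abs_nonneg _) fun j hj => ?_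
    have hjk : j + 1 ≤ k := Finset.mem_range.1 hj
    have h1 : (2 : ℝ) ^ j * 2 ≤ 2 ^ k := by
      rw [← pow_succ]; exact pow_le_pow_right₀ one_le_two hjk
    have h2 : (1 : ℝ) ≤ 2 ^ j := one_le_pow₀ one_le_two
    have h3 : (2 : ℝ) ^ k = 2 ^ (k - 1 - j) * (2 ^ j * 2) := by
      rw [← pow_succ, ← pow_add]; congr 1; omega
    rw [abs_div, abs_of_nonneg (by positivity), abs_of_neg (by linarith),
      div_le_div_iff₀ (by linarith) (by positivity)]
    have h4 : (1 : ℝ) ≤ 2 ^ (k - 1 - j) := one_le_pow₀ one_le_two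
    rw [h3]
    nlinarith [mul_nonneg (sub_nonneg.2 h4) (sub_nonneg.2 h2)]

/-- Coefficients of Seeley's extension operator. -/
theorem exists_seeley_coefficients : ∃ a : ℕ → ℝ,
    (∀ n : ℕ, Summable fun k => |a k| * (2 ^ k) ^ n) ∧
      ∀ n : ℕ, ∑' k, a k * (-(2 : ℝ) ^ k) ^ n = 1 := by
  set x : ℕ → ℝ := fun j => -(2 : ℝ) ^ j with hx
  set C : ℕ → ℝ := fun k => Real.exp 4 * ∏ i ∈ Finset.range k, (2 / 2 ^ i : ℝ) with hC
  have hC0 : ∀ k, 0 ≤ C k := fun k =>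
    mul_nonneg (Real.exp_pos _).le (Finset.prod_nonneg fun _ _ => by positivity)
  have hCsum : ∀ n, Summable fun k => C k * (2 ^ k) ^ n := fun n => by
    simpa only [hC, mul_assoc] using (summable_prod_two_div_two_pow n).mul_left (Real.exp 4)
  -- Lagrange interpolation at `-2 ^ j`, `j < N`, reproduces `X ^ n` for `n < N`; evaluation at `1`
  -- shows that these finite sequences satisfy the first `N` moment conditions.
  set b : ℕ → ℕ → ℝ := fun N k =>
    if k ∈ Finset.range N then (Lagrange.basis (Finset.range N) x k).eval 1 else 0 with hb
  have hbC : ∀ N k, |b N k| ≤ C k := by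
    intro N k
    simp only [hb]
    split_ifs with h
    · exact abs_eval_one_lagrangeBasis_le N k h
    · simpa using hC0 k
  -- A limit along a free ultrafilter exists for every `k` at once by compactness, and the bound `C`
  -- lets dominated convergence carry the moment conditions to it.
  have hlim : ∀ k, ∃ c ∈ Icc (-C k) (C k),
      Tendsto (fun N => b N k) (hyperfilter ℕ : Filter ℕ) (𝓝 c) := by
    intro k
    obtain ⟨c, hc, hle⟩ := (isCompact_Icc (a := -C k) (b := C k)).ultrafilter_le_nhds
      ((hyperfilter ℕ).map fun N => b N k)
      (by
        rw [le_principal_iff]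
        exact (hyperfilter ℕ : Filter ℕ).mem_map.2
          (Eventually.of_forall fun N => abs_le.1 (hbC N k)))
    exact ⟨c, hc, hle⟩
  choose a haC ha using hlim
  have habs : ∀ k, |a k| ≤ C k := fun k => abs_le.2 (haC k)
  refine ⟨a, fun n => (hCsum n).of_nonneg_of_le (fun k => by positivity) fun k => by
    have := habs k; gcongr, fun n => ?_⟩
  have hT : Tendsto (fun N => ∑' k, b N k * x k ^ n) (hyperfilter ℕ : Filter ℕ)
      (𝓝 (∑' k, a k * x k ^ n)) := by
    refine tendsto_tsum_of_dominated_convergence (hCsum n) (fun k => (ha k).mul_const _)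
      (Eventually.of_forall fun (N : ℕ) k => ?_)
    rw [norm_mul, norm_pow, Real.norm_eq_abs, hx, norm_neg, norm_pow, Real.norm_ofNat]
    have := hbC N k
    gcongr
  have hone : ∀ᶠ N in (hyperfilter ℕ : Filter ℕ), ∑' k, b N k * x k ^ n = 1 := by
    have hev : ∀ᶠ N in (atTop : Filter ℕ), ∑' k, b N k * x k ^ n = 1 := by
      filter_upwards [eventually_gt_atTop n] with N hN
      rw [tsum_eq_sum (s := Finset.range N) (fun k hk => by simp only [hb, if_neg hk, zero_mul])]
      have hinj : Set.InjOn x (Finset.range N) := by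
        intro i _ j _ hij
        exact pow_right_injective₀ (a := (2 : ℝ)) (by norm_num) (by norm_num) (neg_injective hij)
      have hint := Lagrange.eq_interpolate (f := (Polynomial.X ^ n : Polynomial ℝ)) hinj
        (by rw [Polynomial.degree_X_pow, Finset.card_range]; exact_mod_cast hN)
      have := congrArg (Polynomial.eval 1) hint
      simp only [Polynomial.eval_pow, Polynomial.eval_X, one_pow, Lagrange.interpolate_apply,
        Polynomial.eval_finsetSum, Polynomial.eval_mul, Polynomial.eval_C] at this
      rw [this]
      exact Finset.sum_congr rfl fun k hk => by simp only [hb, if_pos hk]; ring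
    exact (Nat.hyperfilter_le_atTop : (hyperfilter ℕ : Filter ℕ) ≤ atTop) hev
  exact tendsto_nhds_unique hT ((tendsto_congr' hone).2 tendsto_const_nhds)

end SeeleyCoefficients

end Corners

namespace Corners

/-! ### Termwise differentiation and gluing of Taylor series -/

section TaylorSeries

variable {E G : Type*} [NormedAddCommGroup E] [NormedSpace ℝ E] [NormedAddCommGroup G]
  [NormedSpace ℝ G]

/-- By convexity the mean value inequality bounds the first-order remainder of the `k`-th term by `2
* u k * ‖y - x‖`, so the normalised remainders tend to zero under a summable bound. Working within
`s` covers boundary points. -/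
theorem hasFDerivWithinAt_tsum_of_convex [CompleteSpace G] {s : Set E} (hs : Convex ℝ s)
    {f : ℕ → E → G} {f' : ℕ → E → E →L[ℝ] G} {u : ℕ → ℝ} (hu : Summable u)
    (hf : ∀ k, ∀ x ∈ s, HasFDerivWithinAt (f k) (f' k x) s x)
    (hf' : ∀ k, ∀ x ∈ s, ‖f' k x‖ ≤ u k) (hsum : ∀ x ∈ s, Summable fun k => f k x)
    {x : E} (hx : x ∈ s) :
    HasFDerivWithinAt (fun y => ∑' k, f k y) (∑' k, f' k x) s x := by
  have hs' : Summable fun k => f' k x := Summable.of_norm_bounded hu fun k => hf' k x hx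
  have hrem : ∀ k, ∀ y ∈ s, ‖f k y - f k x - f' k x (y - x)‖ ≤ 2 * u k * ‖y - x‖ := by
    intro k y hy
    refine hs.norm_image_sub_le_of_norm_hasFDerivWithin_le' (hf k) (fun z hz => ?_) hx hy
    calc ‖f' k z - f' k x‖ ≤ ‖f' k z‖ + ‖f' k x‖ := norm_sub_le _ _
      _ ≤ 2 * u k := by linarith [hf' k z hz, hf' k x hx]
  have hbound : ∀ k, ∀ y ∈ s, ‖y - x‖⁻¹ * ‖f k y - f k x - f' k x (y - x)‖ ≤ 2 * u k := by
    intro k y hy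
    have hu0 : 0 ≤ u k := (norm_nonneg _).trans (hf' k x hx)
    rw [mul_comm]
    exact mul_inv_le_of_le_mul₀ (norm_nonneg _) (by positivity) (hrem k y hy)
  rw [hasFDerivWithinAt_iff_tendsto]
  have hlim : Tendsto (fun y => ∑' k, ‖y - x‖⁻¹ * ‖f k y - f k x - f' k x (y - x)‖)
      (𝓝[s] x) (𝓝 (∑' _ : ℕ, (0 : ℝ))) := by
    refine tendsto_tsum_of_dominated_convergence (hu.mul_left 2)
      (fun k => hasFDerivWithinAt_iff_tendsto.1 (hf k x hx)) ?_
    filter_upwards [self_mem_nhdsWithin] with y hy k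
    rw [Real.norm_of_nonneg (by positivity)]
    exact hbound k y hy
  rw [tsum_zero] at hlim
  refine squeeze_zero' (Eventually.of_forall fun y => by positivity) ?_ hlim
  filter_upwards [self_mem_nhdsWithin] with y hy
  have hev : Summable fun k => f' k x (y - x) :=
    (ContinuousLinearMap.apply ℝ G (y - x)).summable hs'
  have h1 : (∑' k, f k y) - (∑' k, f k x) - (∑' k, f' k x) (y - x) =
      ∑' k, (f k y - f k x - f' k x (y - x)) := by
    have h2 : (∑' k, f' k x) (y - x) = ∑' k, f' k x (y - x) :=
      (ContinuousLinearMap.apply ℝ G (y - x)).map_tsum hs'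
    rw [h2, ((hsum y hy).sub (hsum x hx)).tsum_sub hev, (hsum y hy).tsum_sub (hsum x hx)]
  have hn : Summable fun k => ‖f k y - f k x - f' k x (y - x)‖ :=
    Summable.of_nonneg_of_le (fun _ => norm_nonneg _) (fun k => hrem k y hy)
      ((hu.mul_left 2).mul_right _)
  rw [h1, tsum_mul_left]
  gcongr
  exact norm_tsum_le_tsum_norm hn

theorem hasFTaylorSeriesUpToOn_tsum_of_convex [CompleteSpace G] {s : Set E} (hs : Convex ℝ s)
    {f : ℕ → E → G} {P : ℕ → E → FormalMultilinearSeries ℝ E G} {u : ℕ → ℕ → ℝ}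
    (hu : ∀ m, Summable (u m)) (hf : ∀ k, HasFTaylorSeriesUpToOn ∞ (f k) (P k) s)
    (hP : ∀ k m, ∀ x ∈ s, ‖P k x m‖ ≤ u m k) :
    HasFTaylorSeriesUpToOn ∞ (fun x => ∑' k, f k x) (fun x m => ∑' k, P k x m) s := by
  have hsum : ∀ m, ∀ x ∈ s, Summable fun k => P k x m := fun m x hx =>
    Summable.of_norm_bounded (hu m) fun k => hP k m x hx
  refine ⟨fun x hx => ?_, fun m _ x hx => ?_, fun m _ => ?_⟩
  · have h0 : (∑' k, P k x 0).curry0 = ∑' k, (P k x 0).curry0 :=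
      (continuousMultilinearCurryFin0 ℝ E G).toContinuousLinearEquiv.map_tsum
    rw [h0]
    exact tsum_congr fun k => (hf k).zero_eq x hx
  · have h1 : (∑' k, P k x (m + 1)).curryLeft = ∑' k, (P k x (m + 1)).curryLeft :=
      (continuousMultilinearCurryLeftEquiv ℝ (fun _ : Fin (m + 1) => E) G).toContinuousLinearEquiv.map_tsum
    rw [h1]
    refine hasFDerivWithinAt_tsum_of_convex (f := fun k y => P k y m)
      (f' := fun k y => (P k y (m + 1)).curryLeft) hs (hu (m + 1))
      (fun k y hy => (hf k).fderivWithin m (by exact_mod_cast WithTop.coe_lt_top _) y hy)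
      (fun k y hy => ?_) (hsum m) hx
    rw [ContinuousMultilinearMap.curryLeft_norm]
    exact hP k (m + 1) y hy
  · exact continuousOn_tsum (fun k => (hf k).cont m (by exact_mod_cast le_top)) (hu m)
      (fun k x hx => hP k m x hx)

/-- At a point outside one of the closed sets, differentiability within that set is vacuous; at a
common point both derivatives are given by the same `p`. -/
theorem hasFTaylorSeriesUpToOn_union {n : WithTop ℕ∞} {f : E → G}
    {p : E → FormalMultilinearSeries ℝ E G} {s t : Set E} (hs : IsClosed s) (ht : IsClosed t)
    (hfs : HasFTaylorSeriesUpToOn n f p s) (hft : HasFTaylorSeriesUpToOn n f p t) :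
    HasFTaylorSeriesUpToOn n f p (s ∪ t) := by
  refine ⟨fun x hx => hx.elim (hfs.zero_eq x) (hft.zero_eq x), fun m hm x hx => ?_,
    fun m hm => (hfs.cont m hm).union_of_isClosed (hft.cont m hm) hs ht⟩
  have aux : ∀ r : Set E, IsClosed r → HasFTaylorSeriesUpToOn n f p r →
      HasFDerivWithinAt (p · m) (p x m.succ).curryLeft r x := by
    intro r hr hfr
    by_cases hxr : x ∈ r
    · exact hfr.fderivWithin m hm x hxr
    · exact HasFDerivWithinAt.of_notMem_closure (by rwa [hr.closure_eq])
  exact (aux s hs hfs).union (aux t ht hft)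

end TaylorSeries

/-! ### Seeley's extension across one hyperplane -/

section Seeley

variable {E : Type*} [NormedAddCommGroup E] [NormedSpace ℝ E]

/-- The linear map `x ↦ x - (1 + 2 ^ k) λ(x) e`, which multiplies `e` by `-2 ^ k` if `λ(e) = 1`
and fixes the kernel of `λ`. -/
noncomputable def seeleyMap (lam : E →L[ℝ] ℝ) (e : E) (k : ℕ) : E →L[ℝ] E :=
  ContinuousLinearMap.id ℝ E - (1 + 2 ^ k : ℝ) • lam.smulRight e

theorem seeleyMap_apply (lam : E →L[ℝ] ℝ) (e : E) (k : ℕ) (x : E) :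
    seeleyMap lam e k x = x - ((1 + 2 ^ k) * lam x) • e := by
  simp [seeleyMap, smul_smul]

theorem seeleyMap_eq_self {lam : E →L[ℝ] ℝ} {x : E} (hx : lam x = 0) (e : E) (k : ℕ) :
    seeleyMap lam e k x = x := by
  simp [seeleyMap_apply, hx]

theorem apply_seeleyMap {lam : E →L[ℝ] ℝ} {e : E} (he : lam e = 1) (k : ℕ) (x : E) :
    lam (seeleyMap lam e k x) = -2 ^ k * lam x := by
  simp [seeleyMap_apply, he]; ring

theorem norm_seeleyMap_le (lam : E →L[ℝ] ℝ) (e : E) (k : ℕ) :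
    ‖seeleyMap lam e k‖ ≤ (1 + 2 * (‖lam‖ * ‖e‖)) * 2 ^ k := by
  have h2 : (1 : ℝ) ≤ 2 ^ k := one_le_pow₀ one_le_two
  calc ‖seeleyMap lam e k‖ ≤ ‖ContinuousLinearMap.id ℝ E‖ + ‖(1 + 2 ^ k : ℝ) • lam.smulRight e‖ :=
        norm_sub_le _ _
    _ ≤ 1 + (1 + 2 ^ k) * (‖lam‖ * ‖e‖) := by
        rw [norm_smul, ContinuousLinearMap.norm_smulRight_apply,
          Real.norm_of_nonneg (by positivity)]
        gcongr
        exact ContinuousLinearMap.norm_id_le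
    _ ≤ (1 + 2 * (‖lam‖ * ‖e‖)) * 2 ^ k := by
        have : 0 ≤ ‖lam‖ * ‖e‖ := by positivity
        nlinarith

/-- Seeley's extension of a function from the half-space `0 ≤ λ` by a series of reflections
along `e`. -/
noncomputable def seeleyExtension {F : Type*} [AddCommGroup F] [Module ℝ F] [TopologicalSpace F]
    (a : ℕ → ℝ) (lam : E →L[ℝ] ℝ) (e : E) (g : E → F) (x : E) : F :=
  open scoped Classical in
  if 0 ≤ lam x then g x else ∑' k, a k • g (seeleyMap lam e k x)

variable {G : Type*} [NormedAddCommGroup G] [NormedSpace ℝ G]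

/-- This is the matching of `m`-th derivatives on `λ = 0`. Split each `w i` into its `e`-component
and the rest and expand `M` multilinearly: a term with `j` entries along `e` is multiplied by `(-2 ^
k) ^ j`, and the `j`-th moment condition sums these factors to `1`. -/
theorem hasSum_smul_apply_seeleyMap {a : ℕ → ℝ}
    (ha : ∀ n : ℕ, HasSum (fun k => a k * (-(2 : ℝ) ^ k) ^ n) 1) (lam : E →L[ℝ] ℝ) (e : E)
    {m : ℕ} (M : E [×m]→L[ℝ] G) (w : Fin m → E) :
    HasSum (fun k => a k • M fun i => seeleyMap lam e k (w i)) (M w) := by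
  -- The value `c = -2 ^ k` gives the reflected vectors and `c = 1` the original ones.
  have hexp : ∀ c : ℝ, M (fun i => c • (lam (w i) • e) + (w i - lam (w i) • e)) =
      ∑ s : Finset (Fin m), c ^ s.card •
        M (s.piecewise (fun i => lam (w i) • e) fun i => w i - lam (w i) • e) := by
    intro c
    have h := M.toMultilinearMap.map_add_univ (fun i => c • (lam (w i) • e))
      (fun i => w i - lam (w i) • e)
    refine h.trans (Finset.sum_congr rfl fun s _ => ?_)
    have h2 := M.toMultilinearMap.map_piecewise_smul (fun _ => c)
      (s.piecewise (fun i => lam (w i) • e) fun i => w i - lam (w i) • e) s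
    rw [Finset.prod_const] at h2
    refine Eq.trans (congrArg _ ?_) h2
    ext i
    by_cases hi : i ∈ s <;> simp [hi]
  have hA : ∀ k, M (fun i => seeleyMap lam e k (w i)) =
      ∑ s : Finset (Fin m), (-(2 : ℝ) ^ k) ^ s.card •
        M (s.piecewise (fun i => lam (w i) • e) fun i => w i - lam (w i) • e) := by
    intro k
    rw [← hexp]
    congr 1
    ext i
    rw [seeleyMap_apply]
    module
  have hw : M w = ∑ s : Finset (Fin m), (1 : ℝ) •
        M (s.piecewise (fun i => lam (w i) • e) fun i => w i - lam (w i) • e) := by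
    have := hexp 1
    simp only [one_pow, one_smul, add_sub_cancel] at this
    simpa only [one_smul] using this
  rw [hw]
  simp only [hA, Finset.smul_sum, smul_smul]
  exact hasSum_sum fun s _ => (ha s.card).smul_const _

theorem exists_norm_iteratedFDerivWithin_le [FiniteDimensional ℝ E] {S : Set E}
    (hS : IsClosed S) (hu : UniqueDiffOn ℝ S) {g : E → G} (hg : ContDiffOn ℝ ∞ g S) {R : ℝ}
    (hR : ∀ x, R < ‖x‖ → g x = 0) (m : ℕ) :
    ∃ B, 0 ≤ B ∧ ∀ x ∈ S, ‖iteratedFDerivWithin ℝ m g S x‖ ≤ B := by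
  have : ProperSpace E := FiniteDimensional.proper ℝ E
  have hc : ContinuousOn (iteratedFDerivWithin ℝ m g S) (S ∩ Metric.closedBall 0 R) :=
    (hg.continuousOn_iteratedFDerivWithin (by exact_mod_cast le_top) hu).mono inter_subset_left
  obtain ⟨B, hB⟩ := ((isCompact_closedBall (0 : E) R).inter_left hS).exists_bound_of_continuousOn hc
  refine ⟨max B 0, le_max_right _ _, fun x hx => ?_⟩
  by_cases hxR : ‖x‖ ≤ R
  · exact (hB x ⟨hx, by simpa using hxR⟩).trans (le_max_left _ _)
  · have h0 : g =ᶠ[𝓝[S] x] fun _ => (0 : G) := by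
      refine mem_nhdsWithin_of_mem_nhds ?_
      filter_upwards [(isOpen_lt continuous_const continuous_norm).mem_nhds (not_le.1 hxR)]
        with y hy using hR y hy
    rw [h0.iteratedFDerivWithin_eq (hR x (not_le.1 hxR)), iteratedFDerivWithin_fun_zero]
    simp

/-- Stability of `C` under adding nonnegative multiples of `e` ensures that every reflection maps
the side `λ ≤ 0` of `C` into the side where `g` is known. The two sides then carry Taylor series
that agree on their common hyperplane. -/
theorem contDiffOn_seeleyExtension [FiniteDimensional ℝ E] [CompleteSpace G] {a : ℕ → ℝ}
    (ha : ∀ n : ℕ, Summable fun k => |a k| * (2 ^ k) ^ n)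
    (ha' : ∀ n : ℕ, HasSum (fun k => a k * (-(2 : ℝ) ^ k) ^ n) 1)
    {lam : E →L[ℝ] ℝ} {e : E} (he : lam e = 1) {C : Set E} (hC : IsClosed C) (hCc : Convex ℝ C)
    (hCe : ∀ x ∈ C, ∀ t : ℝ, 0 ≤ t → x + t • e ∈ C)
    (hint : (interior (C ∩ {x | 0 ≤ lam x})).Nonempty) {g : E → G}
    (hg : ContDiffOn ℝ ∞ g (C ∩ {x | 0 ≤ lam x})) {R : ℝ} (hR : ∀ x, R < ‖x‖ → g x = 0) :
    ContDiffOn ℝ ∞ (seeleyExtension a lam e g) C := by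
  classical
  set S := C ∩ {x | 0 ≤ lam x} with hSdef
  set T := C ∩ {x | lam x ≤ 0} with hTdef
  have hS : IsClosed S := hC.inter (isClosed_le continuous_const lam.continuous)
  have hT : IsClosed T := hC.inter (isClosed_le lam.continuous continuous_const)
  have hSc : Convex ℝ S := hCc.inter (convex_halfSpace_ge lam.isLinear 0)
  have hTc : Convex ℝ T := hCc.inter (convex_halfSpace_le lam.isLinear 0)
  have hSu : UniqueDiffOn ℝ S := uniqueDiffOn_convex hSc hint
  have hST : S ∪ T = C := by
    rw [hSdef, hTdef, ← inter_union_distrib_left, inter_eq_left]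
    exact fun x _ => le_total 0 (lam x)
  set p := ftaylorSeriesWithin ℝ g S with hp
  have hpT : HasFTaylorSeriesUpToOn ∞ g p S := hg.ftaylorSeriesWithin hSu
  choose B hB0 hB using exists_norm_iteratedFDerivWithin_le hS hSu hg hR
  have hmaps : ∀ k, T ⊆ seeleyMap lam e k ⁻¹' S := by
    intro k x hx
    refine ⟨?_, ?_⟩
    · rw [seeleyMap_apply, sub_eq_add_neg, ← neg_smul]
      exact hCe x hx.1 _ (by
        have : lam x ≤ 0 := hx.2
        have : 0 ≤ (1 + 2 ^ k) * -lam x := mul_nonneg (by positivity) (by linarith)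
        linarith)
    · have : lam x ≤ 0 := hx.2
      change 0 ≤ lam _
      rw [apply_seeleyMap he]
      have : 0 ≤ (2 ^ k) * -lam x := mul_nonneg (by positivity) (by linarith)
      linarith
  set P : ℕ → E → FormalMultilinearSeries ℝ E G := fun k x m =>
    a k • (p (seeleyMap lam e k x) m).compContinuousLinearMap fun _ => seeleyMap lam e k with hP
  have hPT : ∀ k, HasFTaylorSeriesUpToOn ∞ (fun x => a k • g (seeleyMap lam e k x)) (P k) T :=
    fun k => ((hpT.compContinuousLinearMap (seeleyMap lam e k)).mono
      (hmaps k)).continuousLinearMap_comp (a k • ContinuousLinearMap.id ℝ G)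
  set K := 1 + 2 * (‖lam‖ * ‖e‖) with hK
  have hK0 : 0 ≤ K := by positivity
  have hPle : ∀ k m, ∀ x ∈ T, ‖P k x m‖ ≤ (B m * K ^ m) * (|a k| * (2 ^ k) ^ m) := by
    intro k m x hx
    have h1 := ContinuousMultilinearMap.norm_compContinuousLinearMap_le
      (p (seeleyMap lam e k x) m) fun _ => seeleyMap lam e k
    rw [Finset.prod_const, Finset.card_univ, Fintype.card_fin] at h1
    have h2 : ‖p (seeleyMap lam e k x) m‖ ≤ B m := hB m _ (hmaps k hx)
    have h3 := norm_seeleyMap_le lam e k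
    calc ‖P k x m‖ ≤ |a k| * (B m * (K * 2 ^ k) ^ m) := by
          simp only [hP, norm_smul, Real.norm_eq_abs]
          have := hB0 m
          refine mul_le_mul_of_nonneg_left (h1.trans ?_) (abs_nonneg _)
          gcongr
      _ = (B m * K ^ m) * (|a k| * (2 ^ k) ^ m) := by rw [mul_pow]; ring
  have hser := hasFTaylorSeriesUpToOn_tsum_of_convex hTc
    (u := fun m k => (B m * K ^ m) * (|a k| * (2 ^ k) ^ m)) (fun m => (ha m).mul_left _) hPT hPle
  let q : E → FormalMultilinearSeries ℝ E G := fun x m =>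
    if 0 ≤ lam x then p x m else ∑' k, P k x m
  -- All reflections fix `x` here, so only their action on the arguments of the derivative remains.
  have hmatch : ∀ x ∈ T, 0 ≤ lam x → ∀ m, ∑' k, P k x m = p x m := by
    intro x hx hx0 m
    have hx0' : lam x = 0 := le_antisymm hx.2 hx0
    have hsum : Summable fun k => P k x m :=
      Summable.of_norm_bounded ((ha m).mul_left _) fun k => hPle k m x hx
    ext w
    have h1 := hsum.hasSum.mapL (ContinuousMultilinearMap.apply ℝ (fun _ : Fin m => E) G w)
    have h2 := hasSum_smul_apply_seeleyMap ha' lam e (p x m) w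
    refine h1.unique (h2.congr_fun ?_)
    intro k
    simp [hP, seeleyMap_eq_self hx0']
  have hS' : HasFTaylorSeriesUpToOn ∞ (seeleyExtension a lam e g) q S := by
    refine (hpT.congr fun x hx => ?_).congr_series fun m _ x hx => ?_
    · exact if_pos hx.2
    · exact (if_pos hx.2).symm
  have hT' : HasFTaylorSeriesUpToOn ∞ (seeleyExtension a lam e g) q T := by
    refine (hser.congr fun x hx => ?_).congr_series fun m _ x hx => ?_
    · unfold seeleyExtension
      split_ifs with h
      · have hx0 : lam x = 0 := le_antisymm hx.2 h
        have := ((ha' 0).smul_const (g x)).tsum_eq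
        simpa [seeleyMap_eq_self hx0] using this.symm
      · rfl
    · by_cases h : 0 ≤ lam x
      · exact (hmatch x hx h m).trans (if_pos h).symm
      · exact (if_neg h).symm
  have := (hasFTaylorSeriesUpToOn_union hS hT hS' hT').contDiffOn
  rwa [hST] at this

end Seeley

end Corners

namespace Corners

/-! ### Reduction of locally convex spaces to Banach spaces -/

section LocalBanachSpaces

variable {F : Type v} [AddCommGroup F] [Module ℝ F]

/-- A copy of `F`, seminormed by `p`. -/
def SeminormSpace (_p : Seminorm ℝ F) : Type v := F

instance (p : Seminorm ℝ F) : AddCommGroup (SeminormSpace p) := inferInstanceAs (AddCommGroup F)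

instance (p : Seminorm ℝ F) : Module ℝ (SeminormSpace p) := inferInstanceAs (Module ℝ F)

/-- The identity map from `F` to its copy seminormed by `p`. -/
def toSeminormSpace (p : Seminorm ℝ F) : F →ₗ[ℝ] SeminormSpace p := LinearMap.id (R := ℝ) (M := F)

noncomputable instance (p : Seminorm ℝ F) : SeminormedAddCommGroup (SeminormSpace p) :=
  AddGroupSeminorm.toSeminormedAddCommGroup (E := SeminormSpace p) p.toAddGroupSeminorm

noncomputable instance (p : Seminorm ℝ F) : NormedSpace ℝ (SeminormSpace p) where
  norm_smul_le c x := (map_smul_eq_mul p c (show F from x)).le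

/-- The Hausdorff completion of `F` with respect to the seminorm `p`. -/
abbrev LocalBanachSpace (p : Seminorm ℝ F) : Type v := UniformSpace.Completion (SeminormSpace p)

/-- The canonical linear map from `F` to its Hausdorff completion with respect to `p`. -/
noncomputable def toLocalBanachLinearMap (p : Seminorm ℝ F) : F →ₗ[ℝ] LocalBanachSpace p :=
  (UniformSpace.Completion.toComplₗᵢ (𝕜 := ℝ) (E := SeminormSpace p)).toLinearMap ∘ₗ
    toSeminormSpace p

theorem norm_toLocalBanachLinearMap (p : Seminorm ℝ F) (x : F) :
    ‖toLocalBanachLinearMap p x‖ = p x :=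
  (UniformSpace.Completion.toComplₗᵢ (𝕜 := ℝ) (E := SeminormSpace p)).norm_map
    (toSeminormSpace p x)

variable (F) in
/-- The continuous seminorms on `F`. -/
abbrev ContinuousSeminorm [TopologicalSpace F] : Type v := {p : Seminorm ℝ F // Continuous p}

/-- The canonical map from a topological vector space to its local Banach spaces. -/
noncomputable def toLocalBanach [TopologicalSpace F] [IsTopologicalAddGroup F]
    (p : ContinuousSeminorm F) : F →L[ℝ] LocalBanachSpace p.1 where
  toLinearMap := toLocalBanachLinearMap p.1
  cont := by
    refine continuous_of_continuousAt_zero (toLocalBanachLinearMap p.1) ?_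
    rw [ContinuousAt, map_zero, tendsto_zero_iff_norm_tendsto_zero]
    simp only [norm_toLocalBanachLinearMap]
    exact p.2.tendsto' 0 0 (map_zero _)

theorem norm_toLocalBanach [TopologicalSpace F] [IsTopologicalAddGroup F]
    (p : ContinuousSeminorm F) (x : F) : ‖toLocalBanach p x‖ = p.1 x :=
  norm_toLocalBanachLinearMap p.1 x

section Topological

variable [TopologicalSpace F] [IsTopologicalAddGroup F] [ContinuousSMul ℝ F]
  [LocallyConvexSpace ℝ F]

/-- The continuous seminorms generate the topology of a locally convex space, and each is the norm
pulled back from its local Banach space. -/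
theorem isInducing_pi_toLocalBanach :
    IsInducing (ContinuousLinearMap.pi fun p : ContinuousSeminorm F => toLocalBanach p) := by
  rw [IsTopologicalAddGroup.isInducing_iff_nhds_zero,
    (SeminormFamily.withSeminorms_iff_nhds_eq_iInf _).1 (PolynormableSpace.withSeminorms ℝ F),
    nhds_pi, Filter.pi, Filter.comap_iInf]
  refine iInf_congr fun p => ?_
  rw [Filter.comap_comap]
  have : (p.1 : F → ℝ) = norm ∘ toLocalBanach p := funext fun x => (norm_toLocalBanach p x).symm
  rw [this, ← Filter.comap_comap]
  congr 1
  exact comap_norm_nhds_zero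

theorem tendsto_iff_toLocalBanach {α : Type*} {l : Filter α} {f : α → F} {y : F} :
    Tendsto f l (𝓝 y) ↔
      ∀ p : ContinuousSeminorm F, Tendsto (fun x => toLocalBanach p (f x)) l
        (𝓝 (toLocalBanach p y)) := by
  rw [isInducing_pi_toLocalBanach.tendsto_nhds_iff, tendsto_pi_nhds]
  rfl

theorem continuousOn_iff_toLocalBanach {α : Type*} [TopologicalSpace α] {s : Set α} {f : α → F} :
    ContinuousOn f s ↔
      ∀ p : ContinuousSeminorm F, ContinuousOn (fun x => toLocalBanach p (f x)) s :=
  ⟨fun h p x hx => tendsto_iff_toLocalBanach.1 (h x hx) p,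
    fun h x hx => tendsto_iff_toLocalBanach.2 fun p => h p x hx⟩

end Topological

/-- The map to the product of the local Banach spaces is uniformly inducing, so convergence of all
components makes the filter Cauchy in `F`, where completeness supplies a limit. -/
theorem exists_tendsto_of_toLocalBanach [UniformSpace F] [IsUniformAddGroup F]
    [ContinuousSMul ℝ F] [LocallyConvexSpace ℝ F] [CompleteSpace F] {α : Type*} {l : Filter α}
    [l.NeBot] {f : α → F} {z : ∀ p : ContinuousSeminorm F, LocalBanachSpace p.1}
    (h : ∀ p : ContinuousSeminorm F, Tendsto (fun x => toLocalBanach p (f x)) l (𝓝 (z p))) :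
    ∃ y, Tendsto f l (𝓝 y) ∧ ∀ p, toLocalBanach p y = z p := by
  have hind := AddMonoidHom.isUniformInducing_of_isInducing (isInducing_pi_toLocalBanach (F := F))
  have hc : Cauchy (map f l) := by
    rw [← hind.cauchy_map_iff, Filter.map_map]
    exact (tendsto_pi_nhds.2 h).cauchy_map
  obtain ⟨y, hy⟩ := CompleteSpace.complete hc
  refine ⟨y, hy, fun p => tendsto_nhds_unique (tendsto_iff_toLocalBanach.1 hy p) (h p)⟩

end LocalBanachSpaces

end Corners

namespace Corners

/-! ### Differentiability up to the boundary of convex pieces -/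

section ConvexPieces

/-- Relatively open subsets of closed convex sets with nonempty interior. -/
def IsConvexPiece {E : Type*} [AddCommGroup E] [Module ℝ E] [TopologicalSpace E] (T : Set E) :
    Prop :=
  ∃ O C : Set E, IsOpen O ∧ IsClosed C ∧ Convex ℝ C ∧ (interior C).Nonempty ∧ T = O ∩ C

variable {E : Type*} [NormedAddCommGroup E] [NormedSpace ℝ E] {T : Set E}

theorem isConvexPiece_of_isOpen (hT : IsOpen T) : IsConvexPiece T :=
  ⟨T, univ, hT, isClosed_univ, convex_univ, by simp, by simp⟩

theorem IsConvexPiece.prod_univ (hT : IsConvexPiece T) :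
    IsConvexPiece (T ×ˢ (univ : Set E)) := by
  obtain ⟨O, C, hO, hC, hCc, hCi, rfl⟩ := hT
  refine ⟨O ×ˢ univ, C ×ˢ univ, hO.prod isOpen_univ, hC.prod isClosed_univ,
    hCc.prod convex_univ, ?_, ?_⟩
  · rw [interior_prod_eq, interior_univ]
    exact hCi.prod univ_nonempty
  · rw [prod_inter_prod, univ_inter]

theorem IsConvexPiece.uniqueDiffOn (hT : IsConvexPiece T) : UniqueDiffOn ℝ T := by
  obtain ⟨O, C, hO, hC, hCc, hCi, rfl⟩ := hT
  rw [inter_comm]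
  exact (uniqueDiffOn_convex hCc hCi).inter hO

theorem IsConvexPiece.subset_closure_interior (hT : IsConvexPiece T) :
    T ⊆ closure (interior T) := by
  obtain ⟨O, C, hO, hC, hCc, hCi, rfl⟩ := hT
  rw [interior_inter, hO.interior_eq]
  refine Subset.trans ?_ hO.inter_closure
  rw [hCc.closure_interior_eq_closure_of_nonempty_interior hCi]
  exact inter_subset_inter_right _ subset_closure

variable {G : Type*} [NormedAddCommGroup G] [NormedSpace ℝ G]

/-- Near `x` the set is the closure of a convex open set, and a derivative with a limit at the
boundary is a derivative there. -/
theorem IsConvexPiece.hasFDerivWithinAt (hT : IsConvexPiece T) {f : E → G} {L : E → E →L[ℝ] G}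
    (hf : ContinuousOn f T) (hL : ContinuousOn L T)
    (h : ∀ x ∈ interior T, HasFDerivAt f (L x) x) {x : E} (hx : x ∈ T) :
    HasFDerivWithinAt f (L x) T x := by
  obtain ⟨O, C, hO, hC, hCc, hCi, rfl⟩ := hT
  obtain ⟨ε, hε, hεO⟩ := Metric.isOpen_iff.1 hO x hx.1
  set s := Metric.ball x (ε / 2) ∩ interior C with hs
  have hso : IsOpen s := Metric.isOpen_ball.inter isOpen_interior
  have hcl : closure s ⊆ O ∩ C := by
    refine subset_inter ?_ ?_
    · exact ((closure_mono inter_subset_left).trans Metric.closure_ball_subset_closedBall).trans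
        ((Metric.closedBall_subset_ball (by linarith)).trans hεO)
    · exact closure_minimal (inter_subset_right.trans interior_subset) hC
  have hsT : s ⊆ interior (O ∩ C) := interior_maximal (subset_closure.trans hcl) hso
  have hmem : closure s ∈ 𝓝[O ∩ C] x := by
    refine mem_nhdsWithin.2 ⟨Metric.ball x (ε / 2), Metric.isOpen_ball,
      Metric.mem_ball_self (by linarith), ?_⟩
    refine Subset.trans ?_ Metric.isOpen_ball.inter_closure
    rw [hCc.closure_interior_eq_closure_of_nonempty_interior hCi]
    exact inter_subset_inter_right _ (inter_subset_right.trans subset_closure)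
  refine HasFDerivWithinAt.mono_of_mem_nhdsWithin ?_ hmem
  refine hasFDerivWithinAt_closure_of_tendsto_fderiv
    (fun y hy => (h y (hsT hy)).differentiableAt.differentiableWithinAt)
    ((convex_ball _ _).inter hCc.interior) hso
    (fun y hy => (hf y (hcl hy)).mono (subset_closure.trans hcl)) ?_
  refine ((hL x hx).mono (subset_closure.trans hcl)).congr' ?_
  filter_upwards [self_mem_nhdsWithin] with y hy using (h y (hsT hy)).fderiv.symm

end ConvexPieces

/-! ### From directional to Fréchet derivatives -/

section DirectionalDerivatives

variable {E G : Type*} [NormedAddCommGroup E] [NormedSpace ℝ E] [NormedAddCommGroup G]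
  [NormedSpace ℝ G] {U : Set E} {f : E → G} {df : E × E → G}

theorem hasDerivAt_comp_line
    (hd : ∀ x ∈ U, ∀ v : E,
      Tendsto (fun h : ℝ => h⁻¹ • (f (x + h • v) - f x)) (𝓝[≠] 0) (𝓝 (df (x, v))))
    {x v : E} {t : ℝ} (hx : x + t • v ∈ U) :
    HasDerivAt (fun s : ℝ => f (x + s • v)) (df (x + t • v, v)) t := by
  rw [hasDerivAt_iff_tendsto_slope_zero]
  refine (hd _ hx v).congr fun h => ?_
  rw [add_smul, add_assoc]

theorem directionalDerivative_smul
    (hd : ∀ x ∈ U, ∀ v : E,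
      Tendsto (fun h : ℝ => h⁻¹ • (f (x + h • v) - f x)) (𝓝[≠] 0) (𝓝 (df (x, v))))
    {x : E} (hx : x ∈ U) (c : ℝ) (v : E) : df (x, c • v) = c • df (x, v) := by
  have h1 : HasDerivAt (fun s : ℝ => f (x + s • c • v)) (df (x, c • v)) 0 := by
    simpa using hasDerivAt_comp_line (x := x) (v := c • v) (t := 0) hd (by simpa using hx)
  have h2 : HasDerivAt (fun s : ℝ => f (x + s • v)) (df (x, v)) (0 * c) := by
    simpa using hasDerivAt_comp_line (x := x) (v := v) (t := 0) hd (by simpa using hx)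
  have h3 := h2.scomp (0 : ℝ) ((hasDerivAt_id (0 : ℝ)).mul_const c)
  refine h1.unique ?_
  simpa [Function.comp_def, mul_smul] using h3

/-- Compactness of the unit ball makes `df (y, ·)` uniformly close to `df (x, ·)`, homogeneity
removes the restriction to unit vectors, and the mean value inequality integrates along the segment.
The free base point `y` is what additivity needs below. -/
theorem eventually_norm_sub_sub_directionalDerivative_le [FiniteDimensional ℝ E]
    (hU : IsOpen U)
    (hd : ∀ x ∈ U, ∀ v : E,
      Tendsto (fun h : ℝ => h⁻¹ • (f (x + h • v) - f x)) (𝓝[≠] 0) (𝓝 (df (x, v))))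
    (hdf : ContinuousOn df (U ×ˢ univ)) {x : E} (hx : x ∈ U) {ε : ℝ} (hε : 0 < ε) :
    ∃ δ > 0, ∀ y ∈ Metric.ball x δ, ∀ u : E, y + u ∈ Metric.ball x δ →
      ‖f (y + u) - f y - df (x, u)‖ ≤ ε * ‖u‖ := by
  have : ProperSpace E := FiniteDimensional.proper ℝ E
  have hK : ∀ᶠ y in 𝓝 x, ∀ w ∈ Metric.closedBall (0 : E) 1, ‖df (y, w) - df (x, w)‖ < ε := by
    refine (isCompact_closedBall (0 : E) 1).eventually_forall_of_forall_eventually fun w _ => ?_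
    have h1 : ContinuousAt df (x, w) :=
      hdf.continuousAt ((hU.prod isOpen_univ).mem_nhds ⟨hx, mem_univ w⟩)
    have h2 : Tendsto (fun z : E × E => df (x, z.2)) (𝓝 (x, w)) (𝓝 (df (x, w))) :=
      h1.tendsto.comp (Continuous.tendsto' (by fun_prop) _ _ rfl)
    have h3 : Tendsto (fun z : E × E => ‖df z - df (x, z.2)‖) (𝓝 (x, w)) (𝓝 0) := by
      simpa using (h1.tendsto.sub h2).norm
    exact h3.eventually_lt_const hε
  obtain ⟨δ, hδ, hball⟩ := Metric.eventually_nhds_iff_ball.1 (hK.and (hU.mem_nhds hx))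
  refine ⟨δ, hδ, fun y hy u hyu => ?_⟩
  have hseg : ∀ t ∈ Icc (0 : ℝ) 1, y + t • u ∈ Metric.ball x δ := by
    intro t ht
    have := (convex_ball x δ).add_smul_sub_mem hy hyu ht
    simpa using this
  have hest : ∀ z ∈ Metric.ball x δ, ‖df (z, u) - df (x, u)‖ ≤ ε * ‖u‖ := by
    intro z hz
    rcases eq_or_ne u 0 with rfl | hu
    · have h0 : ∀ z ∈ U, df (z, 0) = 0 := fun z hz => by
        simpa using directionalDerivative_smul hd hz 0 0
      simp [h0 z (hball z hz).2, h0 x hx]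
    · have hu' : ‖u‖ ≠ 0 := norm_ne_zero_iff.2 hu
      have h1 : u = ‖u‖ • (‖u‖⁻¹ • u) := by rw [smul_smul, mul_inv_cancel₀ hu', one_smul]
      rw [h1, directionalDerivative_smul hd (hball z hz).2, directionalDerivative_smul hd hx,
        ← smul_sub, norm_smul, norm_norm, ← h1, mul_comm]
      gcongr
      refine ((hball z hz).1 _ ?_).le
      rw [mem_closedBall_zero_iff, norm_smul, norm_inv, norm_norm, inv_mul_cancel₀ hu']
  have hder : ∀ t ∈ Icc (0 : ℝ) 1, HasDerivWithinAt (fun s : ℝ => f (y + s • u) - s • df (x, u))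
      (df (y + t • u, u) - df (x, u)) (Icc 0 1) t := by
    intro t ht
    have h1 := (hasDerivAt_comp_line hd (hball _ (hseg t ht)).2).sub
      ((hasDerivAt_id t).smul_const (df (x, u)))
    rw [one_smul] at h1
    exact h1.hasDerivWithinAt
  have := norm_image_sub_le_of_norm_deriv_le_segment_01' hder
    fun t ht => hest _ (hseg t (Ico_subset_Icc_self ht))
  simpa [sub_right_comm] using this

theorem exists_hasFDerivAt_of_directionalDerivative [FiniteDimensional ℝ E] (hU : IsOpen U)
    (hd : ∀ x ∈ U, ∀ v : E,
      Tendsto (fun h : ℝ => h⁻¹ • (f (x + h • v) - f x)) (𝓝[≠] 0) (𝓝 (df (x, v))))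
    (hdf : ContinuousOn df (U ×ˢ univ)) {x : E} (hx : x ∈ U) :
    ∃ L : E →L[ℝ] G, (∀ v, L v = df (x, v)) ∧ HasFDerivAt f L x := by
  -- The increment along `h • (v + w)` is compared with the path `h • v`, then `h • w`; the choice
  -- `ε = η / (B + 1)` makes the three errors total at most `h * η`.
  have hadd : ∀ v w, df (x, v + w) = df (x, v) + df (x, w) := by
    intro v w
    rw [← sub_eq_zero, ← norm_eq_zero]
    refine le_antisymm (le_of_forall_pos_le_add fun η hη => ?_) (norm_nonneg _)
    set B := ‖v + w‖ + ‖v‖ + ‖w‖ with hB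
    have hB0 : 0 ≤ B := by positivity
    obtain ⟨δ, hδ, hest⟩ := eventually_norm_sub_sub_directionalDerivative_le hU hd hdf hx
      (ε := η / (B + 1)) (by positivity)
    obtain ⟨h, hh, hhδ⟩ : ∃ h > 0, h * B < δ := by
      refine ⟨δ / (B + 1), by positivity, ?_⟩
      rw [div_mul_eq_mul_div, div_lt_iff₀ (by positivity)]
      nlinarith
    have hmem : ∀ z : E, ‖z‖ ≤ B → x + h • z ∈ Metric.ball x δ := by
      intro z hz
      rw [mem_ball_iff_norm, add_sub_cancel_left, norm_smul, Real.norm_of_nonneg hh.le]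
      exact (mul_le_mul_of_nonneg_left hz hh.le).trans_lt hhδ
    have nv := norm_nonneg v
    have nw := norm_nonneg w
    have nvw := norm_nonneg (v + w)
    have e1 := hest x (Metric.mem_ball_self hδ) (h • (v + w)) (hmem _ (by linarith))
    have e2 := hest x (Metric.mem_ball_self hδ) (h • v) (hmem _ (by linarith))
    have e3 := hest (x + h • v) (hmem _ (by linarith)) (h • w)
      (by rw [add_assoc, ← smul_add]; exact hmem _ (by linarith))
    rw [directionalDerivative_smul hd hx, norm_smul, Real.norm_of_nonneg hh.le] at e1 e2 e3
    rw [add_assoc, ← smul_add] at e3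
    have key : h • (df (x, v + w) - (df (x, v) + df (x, w))) =
        (f (x + h • v) - f x - h • df (x, v)) +
        (f (x + h • (v + w)) - f (x + h • v) - h • df (x, w)) -
        (f (x + h • (v + w)) - f x - h • df (x, v + w)) := by module
    have h4 : h * ‖df (x, v + w) - (df (x, v) + df (x, w))‖ ≤ h * η := by
      calc h * ‖df (x, v + w) - (df (x, v) + df (x, w))‖
          = ‖h • (df (x, v + w) - (df (x, v) + df (x, w)))‖ := by
            rw [norm_smul, Real.norm_of_nonneg hh.le]
        _ ≤ η / (B + 1) * (h * ‖v‖) + η / (B + 1) * (h * ‖w‖) + η / (B + 1) * (h * ‖v + w‖) := by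
            rw [key]
            exact (norm_sub_le _ _).trans (add_le_add ((norm_add_le _ _).trans
              (add_le_add e2 e3)) e1)
        _ = h * (η * (B / (B + 1))) := by rw [hB]; ring
        _ ≤ h * η := by
            have : B / (B + 1) ≤ 1 := div_le_one_of_le₀ (by linarith) (by positivity)
            have : η * (B / (B + 1)) ≤ η * 1 := by gcongr
            have := mul_le_mul_of_nonneg_left this hh.le
            linarith
    rw [zero_add]
    exact le_of_mul_le_mul_left h4 hh
  refine ⟨LinearMap.toContinuousLinearMap
    { toFun := fun v => df (x, v)
      map_add' := hadd
      map_smul' := fun c v => directionalDerivative_smul hd hx c v }, fun v => rfl, ?_⟩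
  rw [hasFDerivAt_iff_isLittleO, Asymptotics.isLittleO_iff]
  intro c hc
  obtain ⟨δ, hδ, hest⟩ := eventually_norm_sub_sub_directionalDerivative_le hU hd hdf hx hc
  filter_upwards [Metric.ball_mem_nhds x hδ] with y hy
  simpa using hest x (Metric.mem_ball_self hδ) (y - x) (by simpa using hy)

end DirectionalDerivatives

/-! ### Comparison of the notions of smoothness -/

section Comparison

theorem IsDifferentialOn.clm_comp {E : Type u} [AddCommGroup E] [Module ℝ E] [TopologicalSpace E]
    {F G : Type v} [AddCommGroup F] [Module ℝ F] [TopologicalSpace F] [AddCommGroup G]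
    [Module ℝ G] [TopologicalSpace G] {f : E → F} {U : Set E} {df : E × E → F}
    (h : IsDifferentialOn f U df) (A : F →L[ℝ] G) :
    IsDifferentialOn (fun x => A (f x)) U (fun x => A (df x)) := by
  refine ⟨A.continuous.comp_continuousOn h.1, fun x hx v => ?_, A.continuous.comp_continuousOn h.2.2⟩
  refine ((A.continuous.tendsto _).comp (h.2.1 x hx v)).congr fun t => ?_
  simp

theorem IsCn.clm_comp {F G : Type v} [AddCommGroup F] [Module ℝ F] [TopologicalSpace F]
    [AddCommGroup G] [Module ℝ G] [TopologicalSpace G] (A : F →L[ℝ] G) (n : ℕ) :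
    ∀ {E : Type u} [AddCommGroup E] [Module ℝ E] [TopologicalSpace E] {f : E → F} {U : Set E},
      IsCn n f U → IsCn n (fun x => A (f x)) U := by
  induction n with
  | zero => exact fun h => A.continuous.comp_continuousOn h
  | succ n ih => exact fun ⟨df, h, hn⟩ => ⟨fun x => A (df x), h.clm_comp A, ih hn⟩

theorem IsCn.contDiffOn {G : Type v} [NormedAddCommGroup G] [NormedSpace ℝ G] (n : ℕ) :
    ∀ {E : Type u} [NormedAddCommGroup E] [NormedSpace ℝ E] [FiniteDimensional ℝ E] {f : E → G}
      {T : Set E}, IsConvexPiece T → IsCn n f T → ContDiffOn ℝ n f T := by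
  induction n with
  | zero =>
    intro E _ _ _ f T hT h
    exact contDiffOn_zero.2 h
  | succ n ih =>
    rintro E _ _ _ f T hT ⟨df, ⟨hf, hd, hdf⟩, hn⟩
    have hdfn : ContDiffOn ℝ n df (T ×ˢ univ) := ih hT.prod_univ hn
    set b := Module.finBasis ℝ E
    -- Assembling the derivative from its values on a basis turns regularity of `df` on the product
    -- into regularity of an operator-valued map.
    set L : E → E →L[ℝ] G := fun x =>
      ∑ i, (LinearMap.toContinuousLinearMap (b.coord i)).smulRight (df (x, b i)) with hLdef
    have hLn : ContDiffOn ℝ n L T := by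
      refine ContDiffOn.sum fun i _ => ?_
      have h1 : ContDiffOn ℝ n (fun x => df (x, b i)) T :=
        hdfn.comp (contDiff_id.prodMk contDiff_const).contDiffOn fun x hx => ⟨hx, mem_univ _⟩
      exact ((ContinuousLinearMap.smulRightL ℝ E G
        (LinearMap.toContinuousLinearMap (b.coord i))).contDiff).comp_contDiffOn h1
    have hLd : ∀ x ∈ interior T, HasFDerivAt f (L x) x := by
      intro x hx
      obtain ⟨A, hA, hAd⟩ := exists_hasFDerivAt_of_directionalDerivative isOpen_interior hd
        (hdf.mono (prod_mono interior_subset subset_rfl)) hx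
      have : L x = A := by
        ext v
        conv_rhs => rw [← b.sum_repr v, map_sum]
        simp [hLdef, ← hA]
      rwa [this]
    have hL : ∀ x ∈ T, HasFDerivWithinAt f (L x) T x := fun x hx =>
      hT.hasFDerivWithinAt hf hLn.continuousOn hLd hx
    rw [Nat.cast_succ, contDiffOn_succ_iff_fderivWithin hT.uniqueDiffOn]
    refine ⟨fun x hx => (hL x hx).differentiableWithinAt, by simp, hLn.congr fun x hx => ?_⟩
    exact (hL x hx).fderivWithin (hT.uniqueDiffOn x hx)

variable {F : Type v} [AddCommGroup F] [Module ℝ F]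

/-- All compositions of `f` with the maps to the local Banach spaces of `F` are smooth on `T`. -/
def SeminormwiseSmoothOn [TopologicalSpace F] [IsTopologicalAddGroup F] {E : Type*}
    [NormedAddCommGroup E] [NormedSpace ℝ E] (f : E → F) (T : Set E) : Prop :=
  ∀ p : ContinuousSeminorm F, ContDiffOn ℝ ∞ (fun x => toLocalBanach p (f x)) T

theorem IsSmooth.seminormwiseSmoothOn [TopologicalSpace F] [IsTopologicalAddGroup F]
    {E : Type u} [NormedAddCommGroup E] [NormedSpace ℝ E] [FiniteDimensional ℝ E] {f : E → F}
    {T : Set E} (hT : IsConvexPiece T) (h : IsSmooth f T) : SeminormwiseSmoothOn f T := fun p =>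
  contDiffOn_infty.2 fun n => ((h n).clm_comp (toLocalBanach p)).contDiffOn n hT

variable [UniformSpace F] [IsUniformAddGroup F] [ContinuousSMul ℝ F] [LocallyConvexSpace ℝ F]
  [CompleteSpace F]

/-- The seminormwise derivatives come from one vector of `F`: at interior points as a limit of
difference quotients, at boundary points as a limit of the vectors found at interior points. -/
theorem SeminormwiseSmoothOn.exists_fderivWithin {E : Type*} [NormedAddCommGroup E]
    [NormedSpace ℝ E] {f : E → F} {T : Set E} (hT : IsConvexPiece T)
    (h : SeminormwiseSmoothOn f T) {x : E} (hx : x ∈ T) (v : E) :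
    ∃ w : F, ∀ p : ContinuousSeminorm F,
      toLocalBanach p w = fderivWithin ℝ (fun y => toLocalBanach p (f y)) T x v := by
  have hint : ∀ x ∈ interior T, ∃ w : F, ∀ p : ContinuousSeminorm F,
      toLocalBanach p w = fderivWithin ℝ (fun y => toLocalBanach p (f y)) T x v := by
    intro x hx
    have hlim : ∀ p : ContinuousSeminorm F,
        Tendsto (fun t : ℝ => toLocalBanach p (t⁻¹ • (f (x + t • v) - f x))) (𝓝[≠] 0)
          (𝓝 (fderivWithin ℝ (fun y => toLocalBanach p (f y)) T x v)) := by
      intro p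
      have h1 : HasFDerivAt (fun y => toLocalBanach p (f y))
          (fderivWithin ℝ (fun y => toLocalBanach p (f y)) T x) x :=
        ((h p).differentiableOn (by simp) x (interior_subset hx)).hasFDerivWithinAt.hasFDerivAt
          (mem_interior_iff_mem_nhds.1 hx)
      refine (h1.hasLineDerivAt v).tendsto_slope_zero.congr fun t => ?_
      simp
    obtain ⟨w, -, hw⟩ := exists_tendsto_of_toLocalBanach hlim
    exact ⟨w, hw⟩
  choose! w hw using hint
  have hne : (𝓝[interior T] x).NeBot :=
    mem_closure_iff_nhdsWithin_neBot.1 (hT.subset_closure_interior hx)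
  have hlim : ∀ p : ContinuousSeminorm F, Tendsto (fun y => toLocalBanach p (w y))
      (𝓝[interior T] x) (𝓝 (fderivWithin ℝ (fun y => toLocalBanach p (f y)) T x v)) := by
    intro p
    have h1 : ContinuousOn (fun y => fderivWithin ℝ (fun y => toLocalBanach p (f y)) T y v) T :=
      ((h p).continuousOn_fderivWithin hT.uniqueDiffOn (by simp)).clm_apply continuousOn_const
    refine ((h1 x hx).mono interior_subset).tendsto.congr' ?_
    filter_upwards [self_mem_nhdsWithin] with y hy using (hw y hy p).symm
  obtain ⟨z, -, hz⟩ := exists_tendsto_of_toLocalBanach hlim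
  exact ⟨z, hz⟩

theorem SeminormwiseSmoothOn.isCn (n : ℕ) :
    ∀ {E : Type u} [NormedAddCommGroup E] [NormedSpace ℝ E] {f : E → F}
      {T : Set E}, IsConvexPiece T → SeminormwiseSmoothOn f T → IsCn n f T := by
  induction n with
  | zero => exact fun hT h => continuousOn_iff_toLocalBanach.2 fun p => (h p).continuousOn
  | succ n ih =>
    intro E _ _ f T hT h
    have hex : ∀ z : E × E, ∃ w : F, z.1 ∈ T → ∀ p : ContinuousSeminorm F,
        toLocalBanach p w = fderivWithin ℝ (fun y => toLocalBanach p (f y)) T z.1 z.2 := by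
      intro z
      by_cases hz : z.1 ∈ T
      · exact (h.exists_fderivWithin hT hz z.2).imp fun w hw _ => hw
      · exact ⟨0, fun h => absurd h hz⟩
    choose df hdf using hex
    have hdfs : SeminormwiseSmoothOn df (T ×ˢ univ) := by
      intro p
      have h1 : ContDiffOn ℝ ∞ (fderivWithin ℝ (fun y => toLocalBanach p (f y)) T) T :=
        (h p).fderivWithin hT.uniqueDiffOn (by simp)
      refine ContDiffOn.congr ?_ fun z hz => hdf z hz.1 p
      exact (h1.comp contDiff_fst.contDiffOn fun z hz => hz.1).clm_apply contDiff_snd.contDiffOn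
    refine ⟨df, ⟨continuousOn_iff_toLocalBanach.2 fun p => (h p).continuousOn,
      fun x hx v => ?_, continuousOn_iff_toLocalBanach.2 fun p => (hdfs p).continuousOn⟩,
      ih hT.prod_univ hdfs⟩
    refine tendsto_iff_toLocalBanach.2 fun p => ?_
    rw [hdf (x, v) (interior_subset hx) p]
    have h1 : HasFDerivAt (fun y => toLocalBanach p (f y))
        (fderivWithin ℝ (fun y => toLocalBanach p (f y)) T x) x :=
      ((h p).differentiableOn (by simp) x (interior_subset hx)).hasFDerivWithinAt.hasFDerivAt
        (mem_interior_iff_mem_nhds.1 hx)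
    refine (h1.hasLineDerivAt v).tendsto_slope_zero.congr fun t => ?_
    simp

theorem isSmooth_iff_seminormwiseSmoothOn {E : Type u} [NormedAddCommGroup E] [NormedSpace ℝ E]
    [FiniteDimensional ℝ E] {f : E → F} {T : Set E} (hT : IsConvexPiece T) :
    IsSmooth f T ↔ SeminormwiseSmoothOn f T :=
  ⟨fun h => h.seminormwiseSmoothOn hT, fun h n => h.isCn n hT⟩

end Comparison

end Corners

namespace Corners

/-! ### Geometry of the cone -/

section Cones

variable {E : Type*} [NormedAddCommGroup E] [NormedSpace ℝ E]

theorem isClosed_cone {N : ℕ} (l : Fin N → E →L[ℝ] ℝ) : IsClosed (cone l) := by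
  simp only [cone, ofPred_forall]
  exact isClosed_iInter fun k => isClosed_le continuous_const (l k).continuous

theorem convex_cone {N : ℕ} (l : Fin N → E →L[ℝ] ℝ) : Convex ℝ (cone l) := by
  simp only [cone, ofPred_forall]
  exact convex_iInter fun k => convex_halfSpace_ge (l k).isLinear 0

theorem cone_succ {N : ℕ} (l : Fin (N + 1) → E →L[ℝ] ℝ) :
    cone l = cone (Fin.tail l) ∩ {x | 0 ≤ l 0 x} := by
  ext x
  simp only [cone, mem_ofPred_eq, mem_inter_iff, Fin.forall_fin_succ, Fin.tail]
  exact and_comm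

theorem isConvexPiece_inter_cone {N : ℕ} {l : Fin N → E →L[ℝ] ℝ}
    (hl : (interior (cone l)).Nonempty) {O : Set E} (hO : IsOpen O) :
    IsConvexPiece (O ∩ cone l) :=
  ⟨O, cone l, hO, isClosed_cone l, convex_cone l, hl, rfl⟩

theorem apply_pos_of_mem_interior {lam : E →L[ℝ] ℝ} (hlam : lam ≠ 0) {S : Set E}
    (hS : S ⊆ {x | 0 ≤ lam x}) {e : E} (he : e ∈ interior S) : 0 < lam e := by
  obtain ⟨w, hw⟩ : ∃ w, lam w ≠ 0 := by
    by_contra! h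
    exact hlam (ContinuousLinearMap.ext h)
  have hcont : ContinuousAt (fun t : ℝ => e - t • (lam w • w)) 0 := by fun_prop
  have hev : ∀ᶠ t : ℝ in 𝓝 0, e - t • (lam w • w) ∈ interior S :=
    hcont.eventually_mem (by simpa using isOpen_interior.mem_nhds he)
  obtain ⟨t, ht, ht0⟩ := ((hev.filter_mono nhdsWithin_le_nhds).and
    (self_mem_nhdsWithin (s := Ioi (0 : ℝ)))).exists
  have h1 : 0 ≤ lam (e - t • (lam w • w)) := hS (interior_subset ht)
  have h2 : 0 < t * (lam w * lam w) := mul_pos ht0 (mul_self_pos.2 hw)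
  simp only [map_sub, map_smul, smul_eq_mul] at h1
  linarith

theorem interior_cone_nonempty_of_mem_target {X : Type*} [TopologicalSpace X] {N : ℕ}
    {l : Fin N → E →L[ℝ] ℝ} {A : Set (CornerChart X l)} (hA : IsDifferentialStructure A)
    {φ : CornerChart X l} (hφ : φ ∈ A) {x : E} (hx : x ∈ φ.target) :
    (interior (cone l)).Nonempty := by
  obtain ⟨O, -, hO⟩ := φ.isOpen_target
  have h1 : (interior φ.target).Nonempty :=
    closure_nonempty_iff.1 ⟨x, hA.dense_interior φ hφ hx⟩
  exact h1.mono (interior_mono (hO ▸ inter_subset_right))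

theorem isConvexPiece_target {X : Type*} [TopologicalSpace X] {N : ℕ}
    {l : Fin N → E →L[ℝ] ℝ} {A : Set (CornerChart X l)} (hA : IsDifferentialStructure A)
    {φ : CornerChart X l} (hφ : φ ∈ A) : IsConvexPiece φ.target := by
  rcases φ.target.eq_empty_or_nonempty with h | ⟨x, hx⟩
  · rw [h]
    exact isConvexPiece_of_isOpen isOpen_empty
  · obtain ⟨O, hO, hOt⟩ := φ.isOpen_target
    rw [hOt]
    exact isConvexPiece_inter_cone (interior_cone_nonempty_of_mem_target hA hφ hx) hO

end Cones

/-! ### Supports and vector values of the reflection series -/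

section SeeleyExtension

variable {E : Type*} [NormedAddCommGroup E] [NormedSpace ℝ E] {lam : E →L[ℝ] ℝ} {e : E} {R : ℝ}

/-- If a reflected point lies in the support ball, `k` and `λ x` cannot both be large. This yields
finiteness of the series off the hyperplane and bounded support of the extension. -/
theorem two_pow_mul_abs_le (he : lam e = 1) {k : ℕ} {x : E} (h : ‖seeleyMap lam e k x‖ ≤ R) :
    2 ^ k * |lam x| ≤ ‖lam‖ * R := by
  have h1 : |lam (seeleyMap lam e k x)| ≤ ‖lam‖ * R := lam.le_opNorm_of_le h
  rwa [apply_seeleyMap he, abs_mul, abs_neg, abs_of_pos (by positivity)] at h1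

theorem finite_setOf_apply_seeleyMap_ne_zero {F : Type*} [Zero F] {g : E → F} (he : lam e = 1) (hR : ∀ x, R < ‖x‖ → g x = 0)
    {x : E} (hx : lam x ≠ 0) : {k | g (seeleyMap lam e k x) ≠ 0}.Finite := by
  have h1 : Tendsto (fun k : ℕ => (2 : ℝ) ^ k * |lam x|) atTop atTop :=
    (tendsto_pow_atTop_atTop_of_one_lt one_lt_two).atTop_mul_const (abs_pos.2 hx)
  have h2 : ∀ᶠ k : ℕ in cofinite, g (seeleyMap lam e k x) = 0 := by
    rw [Nat.cofinite_eq_atTop]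
    filter_upwards [h1.eventually_gt_atTop (‖lam‖ * R)] with k hk
    refine hR _ ?_
    by_contra! h
    exact (two_pow_mul_abs_le he h).not_gt hk
  exact h2

variable {F : Type*} [AddCommGroup F] [Module ℝ F] [TopologicalSpace F] {g : E → F}

theorem seeleyExtension_eq_zero (a : ℕ → ℝ) (he : lam e = 1) (hR0 : 0 ≤ R)
    (hR : ∀ x, R < ‖x‖ → g x = 0) {x : E} (hx : R + 2 * (‖lam‖ * R) * ‖e‖ < ‖x‖) :
    seeleyExtension a lam e g x = 0 := by
  unfold seeleyExtension
  split_ifs with h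
  · exact hR x (lt_of_le_of_lt (le_add_of_nonneg_right (by positivity)) hx)
  · have h0 : ∀ k, g (seeleyMap lam e k x) = 0 := by
      intro k
      refine hR _ ?_
      by_contra! hk
      have h1 := two_pow_mul_abs_le he hk
      have h2 : x = seeleyMap lam e k x + ((1 + 2 ^ k) * lam x) • e := by
        rw [seeleyMap_apply]; abel
      have h3 : |(1 + 2 ^ k) * lam x| ≤ 2 * (‖lam‖ * R) := by
        rw [abs_mul, abs_of_pos (by positivity)]
        have : (1 : ℝ) ≤ 2 ^ k := one_le_pow₀ one_le_two
        have := mul_le_mul_of_nonneg_right this (abs_nonneg (lam x))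
        linarith
      have h4 : ‖x‖ ≤ R + 2 * (‖lam‖ * R) * ‖e‖ := by
        rw [h2]
        refine (norm_add_le _ _).trans (add_le_add hk ?_)
        rw [norm_smul]
        exact mul_le_mul_of_nonneg_right h3 (norm_nonneg _)
      exact h4.not_gt hx
    simp [h0]

/-- Off the hyperplane the sum is finite, so linearity suffices and no convergence in `F` is
involved. -/
theorem map_seeleyExtension {G : Type*} [AddCommGroup G] [Module ℝ G] [TopologicalSpace G]
    [T2Space G] (A : F →L[ℝ] G) (a : ℕ → ℝ) (he : lam e = 1) (hR : ∀ x, R < ‖x‖ → g x = 0)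
    (x : E) :
    A (seeleyExtension a lam e g x) = seeleyExtension a lam e (fun y => A (g y)) x := by
  unfold seeleyExtension
  split_ifs with h
  · rfl
  · have hfin := finite_setOf_apply_seeleyMap_ne_zero he hR (x := x) (fun h0 => h h0.ge)
    have hz : ∀ k ∉ hfin.toFinset, g (seeleyMap lam e k x) = 0 := fun k hk => by
      simpa using hk
    rw [tsum_eq_sum (s := hfin.toFinset) fun k hk => by rw [hz k hk, smul_zero],
      tsum_eq_sum (s := hfin.toFinset) fun k hk => by simp only [hz k hk, map_zero, smul_zero], map_sum]
    simp

end SeeleyExtension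

/-! ### Extension from a cone -/

section Extension

variable {E : Type*} [NormedAddCommGroup E] [NormedSpace ℝ E] [FiniteDimensional ℝ E]
  {F : Type*} [AddCommGroup F] [Module ℝ F] [TopologicalSpace F] [IsTopologicalAddGroup F]

theorem exists_smooth_extension_of_cone (N : ℕ) :
    ∀ (l : Fin N → E →L[ℝ] ℝ), (interior (cone l)).Nonempty → ∀ (g : E → F) (R : ℝ), 0 ≤ R →
      (∀ x, R < ‖x‖ → g x = 0) → SeminormwiseSmoothOn g (cone l) →
      ∃ h : E → F, SeminormwiseSmoothOn h univ ∧ EqOn h g (cone l) := by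
  obtain ⟨a, ha, ha'⟩ := exists_seeley_coefficients
  have ha'' : ∀ n : ℕ, HasSum (fun k => a k * (-(2 : ℝ) ^ k) ^ n) 1 := by
    intro n
    rw [← ha' n]
    refine (Summable.of_norm ?_).hasSum
    simpa [abs_mul, abs_pow] using ha n
  induction N with
  | zero =>
    intro l _ g R _ _ hg
    have : cone l = univ := eq_univ_of_forall fun x k => k.elim0
    rw [this] at hg
    exact ⟨g, hg, fun _ _ => rfl⟩
  | succ N ih =>
    intro l hl g R hR0 hR hg
    -- A zero functional imposes no constraint and admits no reflection.
    by_cases h0 : l 0 = 0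
    · have hc : cone l = cone (Fin.tail l) := by
        rw [cone_succ, inter_eq_left]
        intro x _
        simp [h0]
      rw [hc] at hl hg ⊢
      exact ih _ hl g R hR0 hR hg
    · obtain ⟨e₀, he₀⟩ := hl
      have hpos : 0 < l 0 e₀ := apply_pos_of_mem_interior h0 (fun x (hx : x ∈ cone l) => hx 0) he₀
      -- An interior point of the whole cone is nonnegative under all functionals, so translation by
      -- nonnegative multiples of `e` preserves the cone of the remaining ones.
      set e := (l 0 e₀)⁻¹ • e₀ with hedef
      have he : l 0 e = 1 := by simp [hedef, hpos.ne']
      have hek : ∀ k, 0 ≤ l k e := by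
        intro k
        rw [hedef, map_smul, smul_eq_mul]
        exact mul_nonneg (inv_nonneg.2 hpos.le) (interior_subset he₀ k)
      have hsub : cone l ⊆ cone (Fin.tail l) := by rw [cone_succ]; exact inter_subset_left
      have hS : SeminormwiseSmoothOn (seeleyExtension a (l 0) e g) (cone (Fin.tail l)) := by
        intro p
        have h1 := contDiffOn_seeleyExtension ha ha'' he (isClosed_cone (Fin.tail l))
          (convex_cone _) (fun x hx t ht k => ?_) (by rw [← cone_succ]; exact ⟨e₀, he₀⟩)
          (by rw [← cone_succ]; exact hg p) (R := R)
          (fun x hx => by rw [hR x hx, map_zero])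
        · exact h1.congr fun x _ => map_seeleyExtension _ a he hR x
        · rw [map_add, map_smul, smul_eq_mul]
          exact add_nonneg (hx k) (mul_nonneg ht (hek k.succ))
      obtain ⟨h, hh, hhg⟩ := ih (Fin.tail l) ⟨e₀, interior_mono hsub he₀⟩
        (seeleyExtension a (l 0) e g) (R + 2 * (‖l 0‖ * R) * ‖e‖) (by positivity)
        (fun x hx => seeleyExtension_eq_zero a he hR0 hR hx) hS
      exact ⟨h, hh, fun x hx => (hhg (hsub hx)).trans (if_pos (hx 0))⟩

/-- A bump function supported in `O` and equal to `1` on `V` reduces to bounded support. That `V`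
precedes `f` makes the final neighbourhood work for all functions. -/
theorem exists_local_smooth_extension {N : ℕ} {l : Fin N → E →L[ℝ] ℝ}
    (hl : (interior (cone l)).Nonempty) {O : Set E} (hO : IsOpen O) {x : E} (hx : x ∈ O) :
    ∃ V : Set E, IsOpen V ∧ x ∈ V ∧ V ⊆ O ∧ ∀ f : E → F, SeminormwiseSmoothOn f (O ∩ cone l) →
      ∃ g : E → F, SeminormwiseSmoothOn g univ ∧ EqOn g f (V ∩ cone l) := by
  obtain ⟨ε, hε, hεO⟩ := Metric.isOpen_iff.1 hO x hx
  let χ : ContDiffBump x := ⟨ε / 4, ε / 2, by positivity, by linarith⟩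
  have hsupp : tsupport χ ⊆ O := by
    rw [χ.tsupport_eq]
    exact (Metric.closedBall_subset_ball (by change ε / 2 < ε; linarith)).trans hεO
  refine ⟨Metric.ball x (ε / 4), Metric.isOpen_ball, Metric.mem_ball_self (by positivity),
    (Metric.ball_subset_ball (by linarith)).trans hεO, fun f hf => ?_⟩
  have hg : SeminormwiseSmoothOn (fun y => χ y • f y) (cone l) := by
    intro p y hy
    simp only [map_smul]
    by_cases hyO : y ∈ O
    · have h1 := hf p y ⟨hyO, hy⟩
      rw [inter_comm, contDiffWithinAt_inter (hO.mem_nhds hyO)] at h1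
      exact χ.contDiff.contDiffAt.contDiffWithinAt.smul h1
    · have h0 : (χ : E → ℝ) =ᶠ[𝓝 y] 0 :=
        notMem_tsupport_iff_eventuallyEq.1 fun h => hyO (hsupp h)
      refine (contDiffAt_const (c := (0 : LocalBanachSpace p.1))).contDiffWithinAt.congr_of_eventuallyEq_of_mem ?_ hy
      refine mem_nhdsWithin_of_mem_nhds ?_
      filter_upwards [h0] with z hz
      simp [hz]
  have hzero : ∀ y, ‖x‖ + ε < ‖y‖ → χ y • f y = 0 := by
    intro y hy
    have : χ y = 0 := by
      refine χ.zero_of_le_dist ?_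
      change ε / 2 ≤ dist y x
      rw [dist_eq_norm]
      have := norm_sub_norm_le y x
      linarith
    rw [this, zero_smul]
  obtain ⟨g, hgs, hgf⟩ := exists_smooth_extension_of_cone N l hl (fun y => χ y • f y)
    (‖x‖ + ε) (by positivity) hzero hg
  refine ⟨g, hgs, fun y hy => ?_⟩
  rw [hgf hy.2]
  have : χ y = 1 := χ.one_of_mem_closedBall (Metric.ball_subset_closedBall hy.1)
  simp [this]

end Extension

end Corners

namespace Corners

/-! ### Second countable pieces of a paracompact manifold -/

section Paracompact

open TopologicalSpace

/-- Starting from `{x}`, repeatedly take the compact sets belonging to those members of a locally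
finite cover that meet the current set; only finitely many do. The union absorbs every member that
meets it, hence is open and closed. -/
theorem exists_isClopen_isSigmaCompact {X : Type*} [TopologicalSpace X] [T2Space X]
    [ParacompactSpace X] [LocallyCompactSpace X] (x : X) :
    ∃ S : Set X, x ∈ S ∧ IsClopen S ∧ IsSigmaCompact S := by
  choose K hKc hKn using fun y : X => exists_compact_mem_nhds y
  obtain ⟨v, hvo, hvc, hvl, hvK⟩ := precise_refinement (fun y => interior (K y))
    (fun y => isOpen_interior)
    (eq_univ_of_forall fun y => mem_iUnion.2 ⟨y, mem_interior_iff_mem_nhds.2 (hKn y)⟩)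
  let T : ℕ → Set X := fun n =>
    Nat.rec {x} (fun _ s => ⋃ i ∈ {i | (v i ∩ s).Nonempty}, K i) n
  have hT1 : ∀ n, T (n + 1) = ⋃ i ∈ {i | (v i ∩ T n).Nonempty}, K i := fun n => rfl
  have hTc : ∀ n, IsCompact (T n) := by
    intro n
    induction n with
    | zero => exact isCompact_singleton
    | succ n ih =>
      rw [hT1]
      exact (hvl.finite_nonempty_inter_compact ih).isCompact_biUnion fun i _ => hKc i
  have hvT : ∀ n i, (v i ∩ T n).Nonempty → v i ⊆ ⋃ n, T n := by
    intro n i hi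
    refine Subset.trans ?_ (subset_iUnion T (n + 1))
    rw [hT1]
    exact ((hvK i).trans interior_subset).trans (subset_biUnion_of_mem (u := K) hi)
  have hex : ∀ y, ∃ i, y ∈ v i := fun y => mem_iUnion.1 (hvc ▸ mem_univ y)
  refine ⟨⋃ n, T n, mem_iUnion.2 ⟨0, mem_singleton x⟩, ⟨?_, ?_⟩,
    isSigmaCompact_iUnion_of_isCompact T hTc⟩
  · refine isClosed_of_closure_subset fun y hy => ?_
    obtain ⟨i, hi⟩ := hex y
    obtain ⟨z, hzi, hz⟩ := mem_closure_iff.1 hy (v i) (hvo i) hi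
    obtain ⟨n, hn⟩ := mem_iUnion.1 hz
    exact hvT n i ⟨z, hzi, hn⟩ hi
  · refine isOpen_iff_mem_nhds.2 fun y hy => ?_
    obtain ⟨n, hn⟩ := mem_iUnion.1 hy
    obtain ⟨i, hi⟩ := hex y
    exact mem_of_superset ((hvo i).mem_nhds hi) (hvT n i ⟨y, hi, hn⟩)

variable (E : Type*) [NormedAddCommGroup E] [NormedSpace ℝ E] [FiniteDimensional ℝ E]

/-- The pieces are the connected components, of which there may be uncountably many; each lies in a
σ-compact clopen set. -/
theorem exists_secondCountable_open_partition (M : Type*) [TopologicalSpace M] [T2Space M]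
    [ParacompactSpace M] [ChartedSpace E M] :
    ∃ c : M → Opens M, (∀ x, x ∈ c x) ∧ (∀ x, ∀ y ∈ c x, c y = c x) ∧
      ∀ x, SecondCountableTopology (c x) := by
  have : ProperSpace E := FiniteDimensional.proper ℝ E
  have : LocallyCompactSpace M := ChartedSpace.locallyCompactSpace E M
  have : LocallyConnectedSpace M := ChartedSpace.locallyConnectedSpace E M
  refine ⟨fun x => ⟨connectedComponent x, isOpen_connectedComponent⟩,
    fun x => mem_connectedComponent, fun x y hy => Opens.ext (connectedComponent_eq hy).symm,
    fun x => ?_⟩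
  obtain ⟨S, hx, hS, hSc⟩ := exists_isClopen_isSigmaCompact x
  have h1 : IsSigmaCompact (connectedComponent x) :=
    hSc.of_isClosed_subset isClosed_connectedComponent (hS.connectedComponent_subset hx)
  have : SigmaCompactSpace (⟨connectedComponent x, isOpen_connectedComponent⟩ : Opens M) :=
    isSigmaCompact_iff_sigmaCompactSpace.1 h1
  exact ChartedSpace.secondCountable_of_sigmaCompact E _

end Paracompact

/-! ### Gluing with partitions of unity -/

section Gluing

open TopologicalSpace

variable {E : Type*} [NormedAddCommGroup E] [NormedSpace ℝ E] [FiniteDimensional ℝ E]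
  {F : Type*} [AddCommGroup F] [Module ℝ F] [TopologicalSpace F] [IsTopologicalAddGroup F]
  {M : Type*} [TopologicalSpace M] [T2Space M] [ChartedSpace E M] [IsManifold 𝓘(ℝ, E) ∞ M]
  {ι : Type*} {W : ι → Set M} {h : ι → M → F}

theorem exists_glue_of_secondCountable (hW : ∀ i, IsOpen (W i))
    (hh : ∀ i, ∀ p : ContinuousSeminorm F,
      ContMDiffOn 𝓘(ℝ, E) 𝓘(ℝ, LocalBanachSpace p.1) ∞ (fun x => toLocalBanach p (h i x)) (W i))
    (N : Opens M) [SecondCountableTopology N] (hN : (N : Set M) ⊆ ⋃ i, W i) :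
    ∃ g : M → F,
      (∀ p : ContinuousSeminorm F,
        ContMDiffOn 𝓘(ℝ, E) 𝓘(ℝ, LocalBanachSpace p.1) ∞ (fun x => toLocalBanach p (g x)) N) ∧
      ∀ x ∈ N, ∀ c : F, (∀ i, x ∈ W i → h i x = c) → g x = c := by
  have : ProperSpace E := FiniteDimensional.proper ℝ E
  have : LocallyCompactSpace N := ChartedSpace.locallyCompactSpace E N
  obtain ⟨ρ, hρ⟩ := SmoothPartitionOfUnity.exists_isSubordinate 𝓘(ℝ, E) (M := N) isClosed_univ
    (fun i => Subtype.val ⁻¹' W i) (fun i => (hW i).preimage continuous_subtype_val)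
    (fun x _ => by simpa using hN x.2)
  set g₀ : N → F := fun x => ∑ᶠ i, ρ i x • h i x with hg₀
  have hval : ∀ x : N, Function.extend Subtype.val g₀ 0 (x : M) = g₀ x := fun x =>
    Subtype.val_injective.extend_apply g₀ 0 x
  refine ⟨Function.extend Subtype.val g₀ 0, fun p x hx => ?_, fun x hx c hc => ?_⟩
  · have h1 : ContMDiff 𝓘(ℝ, E) 𝓘(ℝ, LocalBanachSpace p.1) ∞
        fun x : N => ∑ᶠ i, ρ i x • toLocalBanach p (h i x) :=
      hρ.contMDiff_finsum_smul (fun i => (hW i).preimage continuous_subtype_val)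
        fun i => (hh i p).comp contMDiff_subtype_val.contMDiffOn fun x hx => hx
    refine ContMDiffAt.contMDiffWithinAt ?_
    refine (contMDiffAt_subtype_iff (x := (⟨x, hx⟩ : N))).1 ?_
    refine (h1 ⟨x, hx⟩).congr_of_eventuallyEq (Eventually.of_forall fun y => ?_)
    have hfin : (Function.support fun i => ρ i y • h i y).Finite :=
      (ρ.locallyFinite.point_finite y).subset fun i hi hi0 => hi (by
        have : ρ i y = 0 := hi0
        simp [this])
    beta_reduce
    rw [hval y]
    change toLocalBanach p (∑ᶠ i, ρ i y • h i y) = _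
    rw [map_finsum (toLocalBanach p) hfin]
    simp
  · rw [hval ⟨x, hx⟩, hg₀]
    have h1 : ∀ i, ρ i ⟨x, hx⟩ • h i x = ρ i ⟨x, hx⟩ • c := by
      intro i
      by_cases hi : ρ i ⟨x, hx⟩ = 0
      · simp [hi]
      · rw [hc i (hρ i (subset_tsupport _ hi))]
    simp only [h1]
    rw [← finsum_smul, ρ.sum_eq_one (mem_univ _), one_smul]

theorem exists_glue [ParacompactSpace M] (hW : ∀ i, IsOpen (W i))
    (hh : ∀ i, ∀ p : ContinuousSeminorm F,
      ContMDiffOn 𝓘(ℝ, E) 𝓘(ℝ, LocalBanachSpace p.1) ∞ (fun x => toLocalBanach p (h i x)) (W i)) :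
    ∃ g : M → F,
      (∀ p : ContinuousSeminorm F,
        ContMDiffOn 𝓘(ℝ, E) 𝓘(ℝ, LocalBanachSpace p.1) ∞ (fun x => toLocalBanach p (g x))
          (⋃ i, W i)) ∧
      ∀ x ∈ ⋃ i, W i, ∀ c : F, (∀ i, x ∈ W i → h i x = c) → g x = c := by
  obtain ⟨c, hc, hcc, hcs⟩ := exists_secondCountable_open_partition E M
  let U : Opens M := ⟨⋃ i, W i, isOpen_iUnion hW⟩
  -- The glued map is chosen per open set, not per point, so that all points of one piece use the
  -- same map.
  have hex : ∀ C : Opens M, ∃ g : M → F, SecondCountableTopology C →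
      (∀ p : ContinuousSeminorm F,
        ContMDiffOn 𝓘(ℝ, E) 𝓘(ℝ, LocalBanachSpace p.1) ∞ (fun x => toLocalBanach p (g x))
          (C ⊓ U : Opens M)) ∧
      ∀ x ∈ C ⊓ U, ∀ c : F, (∀ i, x ∈ W i → h i x = c) → g x = c := by
    intro C
    by_cases hC : SecondCountableTopology C
    · have : SecondCountableTopology (C ⊓ U : Opens M) :=
        (IsEmbedding.inclusion (inf_le_left : C ⊓ U ≤ C)).secondCountableTopology
      obtain ⟨g, hg⟩ := exists_glue_of_secondCountable hW hh (C ⊓ U) fun x hx => hx.2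
      exact ⟨g, fun _ => hg⟩
    · exact ⟨0, fun h => absurd h hC⟩
  choose g hg using hex
  refine ⟨fun x => g (c x) x, fun p x hx => ?_,
    fun x hx => (hg (c x) (hcs x)).2 x ⟨hc x, hx⟩⟩
  have h1 := ((hg (c x) (hcs x)).1 p).contMDiffAt ((c x ⊓ U).isOpen.mem_nhds ⟨hc x, hx⟩)
  refine ContMDiffAt.contMDiffWithinAt (h1.congr_of_eventuallyEq ?_)
  filter_upwards [(c x).isOpen.mem_nhds (hc x)] with y hy
  rw [hcc x y hy]

end Gluing

end Corners

namespace Corners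

/-! ### The three assertions -/

section Main

variable {E : Type u} [NormedAddCommGroup E] [NormedSpace ℝ E] [FiniteDimensional ℝ E]
  {F : Type v} [AddCommGroup F] [Module ℝ F] [UniformSpace F] [IsUniformAddGroup F]
  [ContinuousSMul ℝ F] [LocallyConvexSpace ℝ F] [CompleteSpace F]

theorem exists_smooth_extension_of_open_inter_cone {N : ℕ} {l : Fin N → E →L[ℝ] ℝ}
    (hl : (interior (cone l)).Nonempty) {O : Set E} (hO : IsOpen O) :
    ∃ U' : Set E, IsOpen U' ∧ O ∩ cone l ⊆ U' ∧ ∀ f : E → F, IsSmooth f (O ∩ cone l) →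
      ∃ g : E → F, IsSmooth g U' ∧ EqOn g f (O ∩ cone l) := by
  choose V hVo hxV hVO hV using fun x : ↥(O ∩ cone l) =>
    exists_local_smooth_extension (F := F) hl hO x.2.1
  have hsub : O ∩ cone l ⊆ ⋃ x, V x := fun x hx => mem_iUnion.2 ⟨⟨x, hx⟩, hxV ⟨x, hx⟩⟩
  refine ⟨⋃ x, V x, isOpen_iUnion hVo, hsub, fun f hf => ?_⟩
  rw [isSmooth_iff_seminormwiseSmoothOn (isConvexPiece_inter_cone hl hO)] at hf
  choose h hhs hhf using fun x => hV x f hf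
  obtain ⟨g, hg, hgc⟩ := exists_glue (E := E) (M := E) (W := V) (h := h) hVo
    fun x p => ((hhs x p).mono (subset_univ _)).contMDiffOn
  refine ⟨g, ?_, fun y hy => hgc y (hsub hy) (f y) fun x hyx => hhf x ⟨hyx, hy.2⟩⟩
  rw [isSmooth_iff_seminormwiseSmoothOn (isConvexPiece_of_isOpen (isOpen_iUnion hVo))]
  exact fun p => contMDiffOn_iff_contDiffOn.1 (hg p)

theorem IsLocallyExtendable.isSmooth {T : Set E} (hT : IsConvexPiece T) {f : E → F}
    (h : IsLocallyExtendable f T) : IsSmooth f T := by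
  rw [isSmooth_iff_seminormwiseSmoothOn hT]
  intro p x hx
  obtain ⟨V, hV, hxV, g, hg, hgf⟩ := h x hx
  rw [isSmooth_iff_seminormwiseSmoothOn (isConvexPiece_of_isOpen hV)] at hg
  refine ((hg p).contDiffAt (hV.mem_nhds hxV)).contDiffWithinAt.congr_of_eventuallyEq_of_mem ?_ hx
  filter_upwards [self_mem_nhdsWithin, mem_nhdsWithin_of_mem_nhds (hV.mem_nhds hxV)] with y hy hyV
  rw [hgf ⟨hy, hyV⟩]

theorem isSmoothMap_iff_isUsualSmoothMap {X : Type*} [TopologicalSpace X] {N : ℕ}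
    {l : Fin N → E →L[ℝ] ℝ} {A : Set (CornerChart X l)} (hA : IsDifferentialStructure A)
    (f : X → F) : IsSmoothMap A f ↔ IsUsualSmoothMap A f := by
  refine ⟨fun h φ hφ x hx => ?_, fun h φ hφ => (h φ hφ).isSmooth (isConvexPiece_target hA hφ)⟩
  obtain ⟨O, hO, hOt⟩ := φ.isOpen_target
  obtain ⟨U', hU', hsub, hext⟩ := exists_smooth_extension_of_open_inter_cone (F := F)
    (interior_cone_nonempty_of_mem_target hA hφ hx) hO
  rw [← hOt] at hsub hext
  obtain ⟨g, hg, hgf⟩ := hext _ (h φ hφ)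
  exact ⟨U', hU', hsub hx, g, hg, hgf.mono inter_subset_left⟩

/-- Without functionals the cone is all of `E`, so chart images are open and the inverse charts
agree with those of `M`. -/
theorem isSmoothMap_restrictedCharts_of_isOpen {M : Type*} [TopologicalSpace M]
    [ChartedSpace E M] {U : Set M} {g : M → F}
    (hg : ∀ p : ContinuousSeminorm F,
      ContMDiffOn 𝓘(ℝ, E) 𝓘(ℝ, LocalBanachSpace p.1) ∞ (fun x => toLocalBanach p (g x)) U) :
    IsSmoothMap (restrictedCharts U (Fin.elim0 : Fin 0 → E →L[ℝ] ℝ)) (fun x : U => g x) := by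
  rintro χ ⟨φ, hφ, hsource, hχφ⟩
  have hT : IsConvexPiece χ.target := by
    obtain ⟨O, hO, hOt⟩ := χ.isOpen_target
    have hc : cone (Fin.elim0 : Fin 0 → E →L[ℝ] ℝ) = univ := eq_univ_of_forall fun x k => k.elim0
    rw [hOt, hc, inter_univ]
    exact isConvexPiece_of_isOpen hO
  have hsymm : ∀ e ∈ χ.target, e ∈ φ.target ∧
      ((χ.toPartialEquiv.symm e : U) : M) = φ.symm e := by
    intro e he
    have h1 : χ.toPartialEquiv.symm e ∈ χ.source := χ.map_target he
    have h2 : ((χ.toPartialEquiv.symm e : U) : M) ∈ φ.source := by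
      rw [hsource] at h1
      exact h1
    have h3 : φ ((χ.toPartialEquiv.symm e : U) : M) = e := by
      rw [← hχφ _ h1]
      exact χ.right_inv he
    refine ⟨h3 ▸ φ.map_source h2, ?_⟩
    rw [← φ.left_inv h2, h3]
  rw [isSmooth_iff_seminormwiseSmoothOn hT]
  intro p
  have h1 : ContMDiffOn 𝓘(ℝ, E) 𝓘(ℝ, LocalBanachSpace p.1) ∞
      (fun e => toLocalBanach p (g (φ.symm e))) χ.target := by
    refine (hg p).comp ((contMDiffOn_symm_of_mem_maximalAtlas hφ).mono fun e he =>
      (hsymm e he).1) fun e he => ?_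
    rw [mem_preimage, ← (hsymm e he).2]
    exact Subtype.coe_prop _
  refine (contMDiffOn_iff_contDiffOn.1 h1).congr fun e he => ?_
  simp only [Function.comp_apply]
  rw [(hsymm e he).2]

theorem exists_smooth_extension_of_submanifold {M : Type*} [TopologicalSpace M] [T2Space M]
    [ParacompactSpace M] [ChartedSpace E M] [IsManifold 𝓘(ℝ, E) ∞ M] {L : Set M} {N : ℕ}
    {l : Fin N → E →L[ℝ] ℝ} (hL : IsDifferentialStructure (restrictedCharts L l)) :
    ∃ (U : Set M) (hLU : L ⊆ U), IsOpen U ∧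
      ∀ f : L → F, IsSmoothMap (restrictedCharts L l) f →
        ∃ g : U → F, IsSmoothMap (restrictedCharts U (Fin.elim0 : Fin 0 → E →L[ℝ] ℝ)) g ∧
          ∀ x : L, g (Set.inclusion hLU x) = f x := by
  choose ψ hψ hxψ using hL.cover
  choose φ hφ hsource hψφ using hψ
  choose O hO hOt using fun x => (ψ x).isOpen_target
  have hmem : ∀ x y : L, (y : M) ∈ (φ x).source →
      y ∈ (ψ x).source ∧ φ x (y : M) ∈ O x ∩ cone l := by
    intro x y hy
    have h1 : y ∈ (ψ x).source := by rw [hsource]; exact hy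
    refine ⟨h1, ?_⟩
    rw [← hψφ x y h1, ← hOt]
    exact (ψ x).map_source h1
  have hxφ : ∀ x : L, (x : M) ∈ (φ x).source := fun x => by
    have := hxψ x
    rwa [hsource] at this
  -- The dummy point is needed because an empty `L` says nothing about the cone.
  have hl : ∀ _ : L, (interior (cone l)).Nonempty := fun x =>
    interior_cone_nonempty_of_mem_target hL ⟨φ x, hφ x, hsource x, hψφ x⟩
      ((ψ x).map_source (hxψ x))
  choose V hVo hxV hVO hV using fun x : L =>
    exists_local_smooth_extension (F := F) (hl x) (hO x) (hmem x x (hxφ x)).2.1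
  set W : L → Set M := fun x => (φ x).source ∩ φ x ⁻¹' V x with hWdef
  have hWo : ∀ x, IsOpen (W x) := fun x => (φ x).isOpen_inter_preimage (hVo x)
  have hLU : L ⊆ ⋃ x, W x := fun x hx => mem_iUnion.2 ⟨⟨x, hx⟩, hxφ ⟨x, hx⟩, hxV ⟨x, hx⟩⟩
  refine ⟨⋃ x, W x, hLU, isOpen_iUnion hWo, fun f hf => ?_⟩
  have hfs : ∀ x, SeminormwiseSmoothOn (f ∘ (ψ x).toPartialEquiv.symm) (O x ∩ cone l) := by
    intro x
    rw [← isSmooth_iff_seminormwiseSmoothOn (isConvexPiece_inter_cone (hl x) (hO x)), ← hOt]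
    exact hf (ψ x) ⟨φ x, hφ x, hsource x, hψφ x⟩
  choose h hhs hhf using fun x => hV x _ (hfs x)
  obtain ⟨g, hg, hgc⟩ := exists_glue (E := E) (M := M) (W := W) (h := fun x y => h x (φ x y)) hWo
    fun x p => ((contDiffOn_univ.1 (hhs x p)).contMDiff).comp_contMDiffOn
      ((contMDiffOn_of_mem_maximalAtlas (hφ x)).mono inter_subset_left)
  refine ⟨fun y => g y, isSmoothMap_restrictedCharts_of_isOpen hg, fun y => ?_⟩
  -- At a point of `L` all available local extensions take the value `f y`, so the glued map does
  -- too.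
  refine hgc y (hLU y.2) (f y) fun x hyx => ?_
  obtain ⟨hyψ, hyO⟩ := hmem x y hyx.1
  rw [hhf x ⟨hyx.2, hyO.2⟩, Function.comp_apply, ← hψφ x y hyψ]
  exact congrArg f ((ψ x).left_inv hyψ)

end Main

end Corners

theorem mainTheorem3
    {E : Type*} [NormedAddCommGroup E] [NormedSpace ℝ E] [FiniteDimensional ℝ E]
    -- `F` is a real Fréchet space
    {F : Type*} [AddCommGroup F] [Module ℝ F] [UniformSpace F] [IsUniformAddGroup F]
    [ContinuousSMul ℝ F] [LocallyConvexSpace ℝ F] [TopologicalSpace.MetrizableSpace F]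
    [CompleteSpace F] :
    -- extension from a submanifold with corners `L` to an open neighbourhood `U`
    (∀ (M : Type*) [TopologicalSpace M] [T2Space M] [ParacompactSpace M] [ChartedSpace E M]
        [IsManifold 𝓘(ℝ, E) ∞ M] (L : Set M) (N : ℕ) (l : Fin N → E →L[ℝ] ℝ),
      L ⊆ closure (interior L) →
      Corners.IsDifferentialStructure (Corners.restrictedCharts L l) →
      ∃ (U : Set M) (hLU : L ⊆ U), IsOpen U ∧
        ∀ f : L → F, Corners.IsSmoothMap (Corners.restrictedCharts L l) f →
          ∃ g : U → F,
            Corners.IsSmoothMap (Corners.restrictedCharts U (Fin.elim0 : Fin 0 → E →L[ℝ] ℝ)) g ∧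
            ∀ x : L, g (Set.inclusion hLU x) = f x) ∧
    -- extension from a relatively open subset `U` of `E⁺` to an open subset of `E`
    (∀ (N : ℕ) (l : Fin N → E →L[ℝ] ℝ), (interior (Corners.cone l)).Nonempty →
      ∀ O : Set E, IsOpen O →
      ∃ U' : Set E, IsOpen U' ∧ O ∩ Corners.cone l ⊆ U' ∧
        ∀ f : E → F, Corners.IsSmooth f (O ∩ Corners.cone l) →
          ∃ g : E → F, Corners.IsSmooth g U' ∧ EqOn g f (O ∩ Corners.cone l)) ∧
    -- on finite-dimensional manifolds with corners the two notions of smoothness agree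
    (∀ (X : Type*) [TopologicalSpace X] [T2Space X] (N : ℕ) (l : Fin N → E →L[ℝ] ℝ)
        (A : Set (Corners.CornerChart X l)), Corners.IsDifferentialStructure A →
      ∀ f : X → F, Corners.IsSmoothMap A f ↔ Corners.IsUsualSmoothMap A f) := by
  refine ⟨fun M _ _ _ _ _ L N l _ hL => Corners.exists_smooth_extension_of_submanifold hL,
    fun N l hl O hO => Corners.exists_smooth_extension_of_open_inter_cone hl hO,
    fun X _ _ N l A hA f => Corners.isSmoothMap_iff_isUsualSmoothMap hA f⟩
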